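/- Let $\Gamma$ be a compact metric graph: finitely many vertices $v\in\mathcal V$ and edges $e\in\mathcal E$ (loops and parallel edges allowed), each edge $e$ being an interval $[0,L(e)]$ with $L(e)\in(0,\infty)$. Let $q\in L^\infty(\Gamma)$ be real-valued. For a function $f$ on $\Gamma$ and a vertex $v$ let $F(v)\in\mathbb C^{\deg(v)}$ be the vector of boundary values of $f$ at the edge ends at $v$ (a loop counts twice), and let $F'(v)$ be the vector of the derivatives at these ends taken in the direction pointing from $v$ into the edges. At each vertex $v$ let $P_{v,\rm D},P_{v,\rm N},P_{v,\rm R}$ be orthogonal projections in $\mathbb C^{\deg(v)}$ with mutually orthogonal ranges and $P_{v,\rm D}+P_{v,\rm N}+P_{v,\rm R}=I$, and let $\Lambda_v$ be an operator in $\operatorname{ran}P_{v,\rm R}$. Let $H$ be the operator in $L^2(\Gamma)$ acting as $(Hf)_e=-f_e''+q_ef_e$ on all $f\in\bigoplus_eH^2(0,L(e))$ such that, for every $v$, $$P_{v,\rm D}F(v)=0,\qquad P_{v,\rm N}F'(v)=0,\qquad P_{v,\rm R}F'(v)=\Lambda_vP_{v,\rm R}F(v).$$ Fix a vertex $v_0$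 and suppose that for all $v\neq v_0$ the operator $\Lambda_v$ is self-adjoint and invertible. An eigenvalue is called simple if its eigenspace is one-dimensional; inner products are linear in the first argument. Let $d=\deg(v_0)$, and let $\mathcal P$ and $\mathcal Q$ be the orthogonal projections of $\mathbb C^{d}$ onto $\operatorname{span}\{(1,\dots,1)^\top\}$ and onto its orthogonal complement. When $H=H_x$ depends on a parameter $x$ in a normed space through the condition at $v_0$, and $\lambda$ is a simple real eigenvalue of $H_{x_0}$ with normalized eigenfunction $f$, we say that "$\lambda$ and $f$ are differentiable with respect to $x$ at $x_0$" if there are an open neighbourhood $U$ of $x_0$, a number $\varepsilon>0$, and maps $x\mapsto\lambda(x)$ and $x\mapsto f(x)$ on $U$ with $\lambda(x_0)=\lambda$ and $f(x_0)=f$ such that for all $x\in U$ the number $\lambda(x)$ is a simple eigenvalue of $H_x$, every eigenvalue of $H_x$ at distance less than $\varepsilon$ from $\lambda$ equals $\lambda(x)$, and $f(x)$ is a normalized (in $L^2(\Gamma)$) eigenfunction of $H_x$ for $\lambda(x)$; and such that $\lambda(\cdot)$ is differentiable on $U$, and $f(\cdot)$ is real-differentiable on $U$ as a map into $\widetilde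 H^1(\Gamma)=\bigoplus_eH^1(0,L(e))$. 1. Let $P_{v_0,\rm R}\neq0$ and let $\Lambda_{v_0}$ be self-adjoint and invertible. Let $\lambda$ be a simple eigenvalue of $H$ and $f$ a corresponding normalized eigenfunction. Then $\lambda$ and $f$ are differentiable with respect to $\Lambda_{v_0}$ (varying, with $P_{v_0,\rm D},P_{v_0,\rm N},P_{v_0,\rm R}$ fixed, in the space of all linear operators in $\operatorname{ran}P_{v_0,\rm R}$; here $\lambda(\cdot)$ is complex differentiable, and it is real-valued at self-adjoint operators in $U$), and the Fréchet derivative of $\lambda$ at $\Lambda_{v_0}$ is $$\lambda'(\Lambda_{v_0})(\widetilde\Lambda)=\big\langle\widetilde\Lambda P_{v_0,\rm R}F(v_0),P_{v_0,\rm R}F(v_0)\big\rangle\qquad\text{for all operators }\widetilde\Lambda\text{ in }\operatorname{ran}P_{v_0,\rm R}.$$ 2. Let $d>0$ and let the condition at $v_0$ be the $\delta$ coupling condition of strength $\alpha\in\mathbb R$, i.e. $P_{v_0,\rm D}=\mathcal Q$, $P_{v_0,\rm N}=0$, $P_{v_0,\rm R}=\mathcal P$, and $\Lambda_{v_0}$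 is multiplication by $\alpha/d$. Let $\lambda$ be a simple eigenvalue and $f$ a corresponding normalized eigenfunction. Then $\lambda$ and $f$ are differentiable with respect to $\alpha\in\mathbb R$, all entries of $F(v_0)$ have a common value $f(v_0)$, and $$\frac{\mathrm d\lambda}{\mathrm d\alpha}(\alpha)=|f(v_0)|^2.$$ 3. Let $d>0$ and let the condition at $v_0$ be the $\delta'$ coupling condition of strength $\beta\in\mathbb R\setminus\{0\}$, i.e. $P_{v_0,\rm D}=0$, $P_{v_0,\rm N}=\mathcal Q$, $P_{v_0,\rm R}=\mathcal P$, and $\Lambda_{v_0}$ is multiplication by $d/\beta$. Let $\lambda$ be a simple eigenvalue and $f$ a corresponding normalized eigenfunction. Then $\lambda$ and $f$ are differentiable with respect to $\frac1\beta$ and with respect to $\beta$, and $$\frac{\mathrm d\lambda}{\mathrm d\frac1\beta}(\beta)=\Big|\sum_{j=1}^{d}F_j(v_0)\Big|^2,\qquad\frac{\mathrm d\lambda}{\mathrm d\beta}(\beta)=-\frac1{\beta^2}\Big|\sum_{j=1}^{d}F_j(v_0)\Big|^2.$$ -/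

import Mathlib

open MeasureTheory Set
open scoped ContDiff ENNReal

noncomputable section

/-! ### Sobolev functions on an interval -/

/-- Lebesgue measure on the interval `(0, ℓ)`. -/
abbrev edgeMeasure (ℓ : ℝ) : Measure ℝ := volume.restrict (Ioo 0 ℓ)

/-- The complex Hilbert space `L²(0, ℓ)`. -/
abbrev EdgeL2 (ℓ : ℝ) := Lp ℂ 2 (edgeMeasure ℓ)

/-- `g ∈ L²(0, ℓ)` is the weak derivative of `u ∈ L²(0, ℓ)`: for every smooth test function `φ` with
compact support in `(0, ℓ)` one has `∫ φ' u = - ∫ φ g`. -/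
def IsWeakDeriv {ℓ : ℝ} (u g : EdgeL2 ℓ) : Prop :=
  ∀ φ : ℝ → ℝ, ContDiff ℝ ∞ φ → HasCompactSupport φ → tsupport φ ⊆ Ioo 0 ℓ →
    ∫ x in Ioo 0 ℓ, deriv φ x • u x = - ∫ x in Ioo 0 ℓ, φ x • g x

/-- The Sobolev space `H¹(0, ℓ)`. -/
def MemH1 {ℓ : ℝ} (u : EdgeL2 ℓ) : Prop := ∃ g : EdgeL2 ℓ, IsWeakDeriv u g

/-- The Sobolev space `H²(0, ℓ)`. -/
def MemH2 {ℓ : ℝ} (u : EdgeL2 ℓ) : Prop := ∃ g : EdgeL2 ℓ, IsWeakDeriv u g ∧ MemH1 g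

open Classical in
/-- The weak derivative of `u` (zero if `u ∉ H¹(0, ℓ)`). -/
def weakDeriv {ℓ : ℝ} (u : EdgeL2 ℓ) : EdgeL2 ℓ :=
  if h : MemH1 u then h.choose else 0

/-- `U` is a representative of the class `u` that is continuous on `[0, ℓ]`. -/
def IsContRep {ℓ : ℝ} (u : EdgeL2 ℓ) (U : ℝ → ℂ) : Prop :=
  ContinuousOn U (Icc 0 ℓ) ∧ u =ᵐ[edgeMeasure ℓ] U

open Classical in
/-- The continuous representative on `[0, ℓ]` of `u` (zero if there is none); its values at `0` and
`ℓ` are the boundary values of `u`. -/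
def contRep {ℓ : ℝ} (u : EdgeL2 ℓ) : ℝ → ℂ :=
  if h : ∃ U, IsContRep u U then h.choose else 0

theorem edge_integrable {ℓ : ℝ} (u : EdgeL2 ℓ) : Integrable u (edgeMeasure ℓ) :=
  (Lp.memLp u).integrable (by norm_num)

/-- A bounded continuous factor keeps integrability. -/
theorem edge_integrable_smul {ℓ : ℝ} {φ : ℝ → ℝ} (hφ : Continuous φ) (hs : HasCompactSupport φ)
    {u : ℝ → ℂ} (hu : Integrable u (edgeMeasure ℓ)) :
    Integrable (fun x => φ x • u x) (edgeMeasure ℓ) := by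
  obtain ⟨M, hM⟩ := hs.exists_bound_of_continuous hφ
  exact hu.bdd_smul M hφ.aestronglyMeasurable (Filter.Eventually.of_forall hM)

theorem edge_ae_eq_zero {ℓ : ℝ} {w : ℝ → ℂ} (hw : Integrable w (edgeMeasure ℓ))
    (h : ∀ φ : ℝ → ℝ, ContDiff ℝ ∞ φ → HasCompactSupport φ → tsupport φ ⊆ Ioo 0 ℓ →
      ∫ x in Ioo 0 ℓ, φ x • w x = 0) : w =ᵐ[edgeMeasure ℓ] 0 := by
  have hl : LocallyIntegrableOn w (Ioo 0 ℓ) volume :=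
    IntegrableOn.locallyIntegrableOn hw
  have := isOpen_Ioo.ae_eq_zero_of_integral_contDiff_smul_eq_zero (U := Ioo 0 ℓ) (f := w)
    (μ := volume) hl (fun g g1 g2 g3 => by
      rw [← h g g1 g2 g3]
      refine (setIntegral_eq_integral_of_forall_compl_eq_zero fun x hx => ?_).symm
      rw [image_eq_zero_of_notMem_tsupport fun hx' => hx (g3 hx'), zero_smul])
  exact (ae_restrict_iff' measurableSet_Ioo).2 this

theorem IsWeakDeriv.unique {ℓ : ℝ} {u g₁ g₂ : EdgeL2 ℓ} (h₁ : IsWeakDeriv u g₁)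
    (h₂ : IsWeakDeriv u g₂) : g₁ = g₂ := by
  have key : (fun x => g₁ x - g₂ x) =ᵐ[edgeMeasure ℓ] 0 := by
    refine edge_ae_eq_zero ((edge_integrable g₁).sub (edge_integrable g₂)) fun φ a b c => ?_
    simp_rw [smul_sub]
    rw [integral_sub (edge_integrable_smul a.continuous b (edge_integrable g₁))
      (edge_integrable_smul a.continuous b (edge_integrable g₂))]
    have e₁ := h₁ φ a b c
    have e₂ := h₂ φ a b c
    rw [sub_eq_zero, ← neg_inj, ← e₁, ← e₂]
  refine Lp.ext ?_
  filter_upwards [key] with x hx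
  exact sub_eq_zero.1 hx

theorem IsWeakDeriv.weakDeriv_eq {ℓ : ℝ} {u g : EdgeL2 ℓ} (h : IsWeakDeriv u g) :
    weakDeriv u = g := by
  have hm : MemH1 u := ⟨g, h⟩
  rw [weakDeriv, dif_pos hm]
  exact hm.choose_spec.unique h

theorem IsWeakDeriv.add {ℓ : ℝ} {u₁ g₁ u₂ g₂ : EdgeL2 ℓ} (h₁ : IsWeakDeriv u₁ g₁)
    (h₂ : IsWeakDeriv u₂ g₂) : IsWeakDeriv (u₁ + u₂) (g₁ + g₂) := by
  intro φ a b c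
  have ad : Continuous (deriv φ) := a.continuous_deriv (by simp)
  have e₁ : ∫ x in Ioo 0 ℓ, deriv φ x • (u₁ + u₂ : EdgeL2 ℓ) x
      = ∫ x in Ioo 0 ℓ, (deriv φ x • u₁ x + deriv φ x • u₂ x) := by
    refine integral_congr_ae ?_
    filter_upwards [Lp.coeFn_add u₁ u₂] with x hx
    rw [hx, Pi.add_apply, smul_add]
  have e₂ : ∫ x in Ioo 0 ℓ, φ x • (g₁ + g₂ : EdgeL2 ℓ) x
      = ∫ x in Ioo 0 ℓ, (φ x • g₁ x + φ x • g₂ x) := by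
    refine integral_congr_ae ?_
    filter_upwards [Lp.coeFn_add g₁ g₂] with x hx
    rw [hx, Pi.add_apply, smul_add]
  rw [e₁, e₂, integral_add (edge_integrable_smul ad b.deriv (edge_integrable u₁))
      (edge_integrable_smul ad b.deriv (edge_integrable u₂)),
    integral_add (edge_integrable_smul a.continuous b (edge_integrable g₁))
      (edge_integrable_smul a.continuous b (edge_integrable g₂)), h₁ φ a b c, h₂ φ a b c]
  ring

theorem IsWeakDeriv.smul {ℓ : ℝ} {u g : EdgeL2 ℓ} (z : ℂ) (h : IsWeakDeriv u g) :
    IsWeakDeriv (z • u) (z • g) := by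
  intro φ a b c
  have e₁ : ∫ x in Ioo 0 ℓ, deriv φ x • (z • u : EdgeL2 ℓ) x
      = ∫ x in Ioo 0 ℓ, z • (deriv φ x • u x) := by
    refine integral_congr_ae ?_
    filter_upwards [Lp.coeFn_smul z u] with x hx
    rw [hx, Pi.smul_apply, smul_comm]
  have e₂ : ∫ x in Ioo 0 ℓ, φ x • (z • g : EdgeL2 ℓ) x
      = ∫ x in Ioo 0 ℓ, z • (φ x • g x) := by
    refine integral_congr_ae ?_
    filter_upwards [Lp.coeFn_smul z g] with x hx
    rw [hx, Pi.smul_apply, smul_comm]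
  rw [e₁, e₂, integral_smul, integral_smul, h φ a b c, smul_neg]

theorem IsWeakDeriv.zero {ℓ : ℝ} : IsWeakDeriv (0 : EdgeL2 ℓ) 0 := by
  intro φ a b c
  have e : ∀ ψ : ℝ → ℝ, ∫ x in Ioo 0 ℓ, ψ x • (0 : EdgeL2 ℓ) x = 0 := by
    intro ψ
    rw [← integral_zero ℝ ℂ (μ := edgeMeasure ℓ)]
    refine integral_congr_ae ?_
    filter_upwards [Lp.coeFn_zero ℂ 2 (edgeMeasure ℓ)] with x hx
    rw [hx, Pi.zero_apply, smul_zero]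
  rw [e, e, neg_zero]

/-- A function whose distributional derivative vanishes is constant. -/
theorem edge_const_of_weakDeriv_zero {ℓ : ℝ} (hℓ : 0 < ℓ) {w : ℝ → ℂ}
    (hw : Integrable w (edgeMeasure ℓ))
    (h : ∀ φ : ℝ → ℝ, ContDiff ℝ ∞ φ → HasCompactSupport φ → tsupport φ ⊆ Ioo 0 ℓ →
      ∫ x in Ioo 0 ℓ, deriv φ x • w x = 0) : ∃ c : ℂ, w =ᵐ[edgeMeasure ℓ] fun _ => c := by
  let b : ContDiffBump (ℓ / 2) := ⟨ℓ / 4, ℓ / 3, by linarith, by linarith⟩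
  let ψ₀ : ℝ → ℝ := b.normed volume
  have p1 : ContDiff ℝ ∞ ψ₀ := b.contDiff_normed
  have p2 : HasCompactSupport ψ₀ := b.hasCompactSupport_normed
  have p3 : tsupport ψ₀ ⊆ Ioo 0 ℓ := by
    change tsupport (b.normed volume) ⊆ _
    rw [b.tsupport_normed_eq, Real.closedBall_eq_Icc]
    intro x hx
    have h1 : ℓ / 2 - ℓ / 3 ≤ x := hx.1
    have h2 : x ≤ ℓ / 2 + ℓ / 3 := hx.2
    exact ⟨by linarith, by linarith⟩
  have p4 : ∫ x, ψ₀ x = 1 := b.integral_normed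
  refine ⟨∫ x in Ioo 0 ℓ, ψ₀ x • w x, ?_⟩
  set c : ℂ := ∫ x in Ioo 0 ℓ, ψ₀ x • w x with hc
  have key : (fun x => w x - c) =ᵐ[edgeMeasure ℓ] 0 := by
    refine edge_ae_eq_zero (hw.sub (integrable_const c)) fun ψ q1 q2 q3 => ?_
    set m : ℝ := ∫ x, ψ x with hm
    let η : ℝ → ℝ := fun x => ψ x - m * ψ₀ x
    have η1 : ContDiff ℝ ∞ η := q1.sub (contDiff_const.mul p1)
    have iψ : Integrable ψ := q1.continuous.integrable_of_hasCompactSupport q2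
    have iψ₀ : Integrable ψ₀ := p1.continuous.integrable_of_hasCompactSupport p2
    have η2 : ∫ x, η x = 0 := by
      change ∫ x, (ψ x - m * ψ₀ x) = 0
      rw [integral_sub iψ (iψ₀.const_mul m), integral_const_mul, p4, mul_one, sub_self]
    set K : Set ℝ := tsupport ψ ∪ tsupport ψ₀ with hK
    have K1 : IsCompact K := q2.union p2
    have K2 : K.Nonempty := by
      refine ⟨ℓ / 2, Or.inr ?_⟩
      change ℓ / 2 ∈ tsupport (b.normed volume)
      rw [b.tsupport_normed_eq]
      exact Metric.mem_closedBall_self (by positivity)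
    have K3 : K ⊆ Ioo 0 ℓ := union_subset q3 p3
    have ha := K3 (K1.sInf_mem K2)
    have hb := K3 (K1.sSup_mem K2)
    set A := sInf K
    set B := sSup K
    have KI : K ⊆ Icc A B := fun x hx => ⟨csInf_le K1.bddBelow hx, le_csSup K1.bddAbove hx⟩
    have η0 : ∀ x, x ∉ Icc A B → η x = 0 := by
      intro x hx
      have h1 : x ∉ tsupport ψ := fun h' => hx (KI (Or.inl h'))
      have h2 : x ∉ tsupport ψ₀ := fun h' => hx (KI (Or.inr h'))
      simp only [η, image_eq_zero_of_notMem_tsupport h1, image_eq_zero_of_notMem_tsupport h2,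
        mul_zero, sub_zero]
    let φ : ℝ → ℝ := fun x => ∫ t in Iic x, η t
    have iη : Integrable η := iψ.sub (iψ₀.const_mul m)
    have φL : ∀ x, x < A → φ x = 0 := by
      intro x hx
      refine setIntegral_eq_zero_of_forall_eq_zero fun t ht => η0 t fun h' => ?_
      exact absurd (h'.1.trans ht) (not_le.2 hx)
    have φR : ∀ x, B < x → φ x = 0 := by
      intro x hx
      change ∫ t in Iic x, η t = 0
      rw [← η2]
      refine setIntegral_eq_integral_of_forall_compl_eq_zero fun t ht => η0 t fun h' => ?_
      exact ht (h'.2.trans hx.le)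
    have φd : ∀ x, HasDerivAt φ (η x) x := by
      intro x
      have e : φ = fun y => (∫ t in (0 : ℝ)..y, η t) + ∫ t in Iic 0, η t := by
        funext y
        rw [← intervalIntegral.integral_Iic_sub_Iic iη.integrableOn iη.integrableOn]
        simp [φ]
      rw [e]
      exact (intervalIntegral.integral_hasDerivAt_right
        (η1.continuous.intervalIntegrable _ _)
        (η1.continuous.stronglyMeasurableAtFilter _ _) η1.continuous.continuousAt).add_const _
    have φ' : deriv φ = η := funext fun x => (φd x).deriv
    have φ1 : ContDiff ℝ ∞ φ := by
      rw [contDiff_infty_iff_deriv]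
      exact ⟨fun x => (φd x).differentiableAt, by rw [φ']; exact η1⟩
    have φs : tsupport φ ⊆ Icc A B := by
      refine closure_minimal (fun x hx => ?_) isClosed_Icc
      by_contra hx'
      rw [mem_Icc, not_and_or, not_le, not_le] at hx'
      exact hx (hx'.elim (φL x) (φR x))
    have φ2 : HasCompactSupport φ := isCompact_Icc.of_isClosed_subset (isClosed_tsupport _) φs
    have φ3 : tsupport φ ⊆ Ioo 0 ℓ := φs.trans fun x hx =>
      ⟨ha.1.trans_le hx.1, hx.2.trans_lt hb.2⟩
    have hz := h φ φ1 φ2 φ3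
    rw [φ'] at hz
    have i1 := edge_integrable_smul (ℓ := ℓ) q1.continuous q2 hw
    have i2 := edge_integrable_smul (ℓ := ℓ) p1.continuous p2 hw
    have e1 : ∫ x in Ioo 0 ℓ, η x • w x = (∫ x in Ioo 0 ℓ, ψ x • w x) - m • c := by
      have i3 : Integrable (fun x => m • (ψ₀ x • w x)) (edgeMeasure ℓ) := i2.smul m
      rw [hc, ← integral_smul, ← integral_sub i1 i3]
      refine integral_congr_ae (Filter.Eventually.of_forall fun x => ?_)
      simp only [η, sub_smul, mul_smul]
    have e2 : ∫ x in Ioo 0 ℓ, ψ x • (w x - c) = (∫ x in Ioo 0 ℓ, ψ x • w x) - m • c := by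
      simp_rw [smul_sub]
      rw [integral_sub i1 (iψ.restrict.smul_const c), integral_smul_const]
      congr 2
      refine setIntegral_eq_integral_of_forall_compl_eq_zero fun x hx => ?_
      exact image_eq_zero_of_notMem_tsupport fun hx' => hx (q3 hx')
    rw [e2, ← e1, hz]
  filter_upwards [key] with x hx
  exact sub_eq_zero.1 hx

/-- Integration by parts for a primitive of an `L²` function. -/
theorem edge_primitive_weakDeriv {ℓ : ℝ} (g : EdgeL2 ℓ) {φ : ℝ → ℝ}
    (a : ContDiff ℝ ∞ φ) (b : HasCompactSupport φ) (c : tsupport φ ⊆ Ioo 0 ℓ) :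
    ∫ x in Ioo 0 ℓ, deriv φ x • (∫ y in (0 : ℝ)..x, g y) = - ∫ x in Ioo 0 ℓ, φ x • g x := by
  have ad : Continuous (deriv φ) := a.continuous_deriv (by simp)
  have hφℓ : φ ℓ = 0 := image_eq_zero_of_notMem_tsupport fun h => lt_irrefl _ (c h).2
  have iφ' : Integrable (deriv φ) (edgeMeasure ℓ) :=
    (ad.integrable_of_hasCompactSupport b.deriv).restrict
  let k : ℝ → ℝ → ℂ := fun x y => (Iio x).indicator (fun y => deriv φ x • g y) y
  have ik : Integrable (Function.uncurry k) ((edgeMeasure ℓ).prod (edgeMeasure ℓ)) := by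
    have h0 : Integrable (fun p : ℝ × ℝ => deriv φ p.1 • g p.2)
        ((edgeMeasure ℓ).prod (edgeMeasure ℓ)) := iφ'.smul_prod (edge_integrable g)
    have hS : MeasurableSet {p : ℝ × ℝ | p.2 < p.1} := measurableSet_lt measurable_snd measurable_fst
    refine (h0.indicator hS).congr (Filter.Eventually.of_forall fun p => ?_)
    simp [k, Function.uncurry, indicator]
  have hswap := integral_integral_swap ik
  have hL : ∫ x in Ioo 0 ℓ, deriv φ x • (∫ y in (0 : ℝ)..x, g y)
      = ∫ x in Ioo 0 ℓ, ∫ y in Ioo 0 ℓ, k x y := by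
    refine setIntegral_congr_fun measurableSet_Ioo fun x hx => ?_
    simp only [k]
    rw [setIntegral_indicator measurableSet_Iio, integral_smul,
      intervalIntegral.integral_of_le hx.1.le, integral_Ioc_eq_integral_Ioo]
    congr 3
    ext y
    simp only [mem_Ioo, mem_inter_iff, mem_Iio]
    exact ⟨fun h => ⟨⟨h.1, h.2.trans hx.2⟩, h.2⟩, fun h => ⟨h.1.1, h.2⟩⟩
  have hR : ∫ y in Ioo 0 ℓ, ∫ x in Ioo 0 ℓ, k x y = ∫ y in Ioo 0 ℓ, - (φ y • g y) := by
    refine setIntegral_congr_fun measurableSet_Ioo fun y hy => ?_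
    have e : ∀ x, k x y = (Ioi y).indicator (fun x => deriv φ x • g y) x := by
      intro x
      simp [k, indicator]
    simp only [e]
    rw [setIntegral_indicator measurableSet_Ioi, integral_smul_const]
    have hI : Ioo 0 ℓ ∩ Ioi y = Ioo y ℓ := by
      ext x
      simp only [mem_Ioo, mem_inter_iff, mem_Ioi]
      exact ⟨fun h => ⟨h.2, h.1.2⟩, fun h => ⟨⟨hy.1.trans h.1, h.2⟩, h.1⟩⟩
    rw [hI, ← integral_Ioc_eq_integral_Ioo, ← intervalIntegral.integral_of_le hy.2.le,
      intervalIntegral.integral_deriv_eq_sub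
        (fun x _ => (a.differentiable (by simp)).differentiableAt) (ad.intervalIntegrable _ _),
      hφℓ, zero_sub, neg_smul]
  rw [hL, hswap, hR, integral_neg]

/-- Every `H¹` function on `(0, ℓ)` has a continuous representative, a primitive of its weak
derivative. -/
theorem IsWeakDeriv.isContRep {ℓ : ℝ} (hℓ : 0 < ℓ) {u g : EdgeL2 ℓ} (h : IsWeakDeriv u g) :
    ∃ c : ℂ, IsContRep u fun x => c + ∫ y in (0 : ℝ)..x, g y := by
  have hcont : ContinuousOn (fun x => ∫ y in (0 : ℝ)..x, g y) (Icc 0 ℓ) := by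
    have := intervalIntegral.continuousOn_primitive_interval (μ := volume) (f := g)
      (a := 0) (b := ℓ) (by
        rw [uIcc_of_le hℓ.le, integrableOn_Icc_iff_integrableOn_Ioo]
        exact edge_integrable g)
    rwa [uIcc_of_le hℓ.le] at this
  have hWi : Integrable (fun x => ∫ y in (0 : ℝ)..x, g y) (edgeMeasure ℓ) :=
    (hcont.integrableOn_compact isCompact_Icc).mono_set Ioo_subset_Icc_self
  obtain ⟨c, hc⟩ := edge_const_of_weakDeriv_zero hℓ
    (w := fun x => u x - ∫ y in (0 : ℝ)..x, g y) ((edge_integrable u).sub hWi)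
    (fun φ p1 p2 p3 => by
      have ad : Continuous (deriv φ) := p1.continuous_deriv (by simp)
      simp_rw [smul_sub]
      rw [integral_sub (edge_integrable_smul ad p2.deriv (edge_integrable u))
        (edge_integrable_smul ad p2.deriv hWi), h φ p1 p2 p3,
        edge_primitive_weakDeriv g p1 p2 p3, sub_self])
  refine ⟨c, continuousOn_const.add hcont, ?_⟩
  filter_upwards [hc] with x hx
  rw [← hx]
  ring

/-- The continuous representative is unique on `[0, ℓ]`. -/
theorem IsContRep.contRep_eqOn {ℓ : ℝ} (hℓ : 0 < ℓ) {u : EdgeL2 ℓ} {U : ℝ → ℂ}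
    (h : IsContRep u U) : EqOn (contRep u) U (Icc 0 ℓ) := by
  have hm : ∃ U, IsContRep u U := ⟨U, h⟩
  rw [contRep, dif_pos hm]
  have hs := hm.choose_spec
  refine Measure.eqOn_Icc_of_ae_eq volume hℓ.ne ?_ hs.1 h.1
  rw [← Measure.restrict_congr_set Ioo_ae_eq_Icc]
  exact hs.2.symm.trans h.2

theorem MemH1.isContRep_contRep {ℓ : ℝ} (hℓ : 0 < ℓ) {u : EdgeL2 ℓ} (h : MemH1 u) :
    IsContRep u (contRep u) := by
  obtain ⟨g, hg⟩ := h
  obtain ⟨c, hc⟩ := hg.isContRep hℓ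
  have hm : ∃ U, IsContRep u U := ⟨_, hc⟩
  rw [contRep, dif_pos hm]
  exact hm.choose_spec

theorem MemH1.contRep_add {ℓ : ℝ} (hℓ : 0 < ℓ) {u v : EdgeL2 ℓ} (hu : MemH1 u) (hv : MemH1 v) :
    EqOn (contRep (u + v)) (contRep u + contRep v) (Icc 0 ℓ) := by
  have h1 := hu.isContRep_contRep hℓ
  have h2 := hv.isContRep_contRep hℓ
  refine IsContRep.contRep_eqOn hℓ ⟨h1.1.add h2.1, ?_⟩
  exact (Lp.coeFn_add u v).trans (h1.2.add h2.2)

theorem MemH1.contRep_smul {ℓ : ℝ} (hℓ : 0 < ℓ) {u : EdgeL2 ℓ} (z : ℂ) (hu : MemH1 u) :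
    EqOn (contRep (z • u)) (z • contRep u) (Icc 0 ℓ) := by
  have h1 := hu.isContRep_contRep hℓ
  refine IsContRep.contRep_eqOn hℓ ⟨h1.1.const_smul z, ?_⟩
  exact (Lp.coeFn_smul z u).trans (h1.2.const_smul z)

theorem MemH2.memH1 {ℓ : ℝ} {u : EdgeL2 ℓ} (h : MemH2 u) : MemH1 u := ⟨_, h.choose_spec.1⟩

theorem MemH1.isWeakDeriv {ℓ : ℝ} {u : EdgeL2 ℓ} (h : MemH1 u) : IsWeakDeriv u (weakDeriv u) := by
  rw [h.choose_spec.weakDeriv_eq]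
  exact h.choose_spec

theorem MemH2.memH1_weakDeriv {ℓ : ℝ} {u : EdgeL2 ℓ} (h : MemH2 u) : MemH1 (weakDeriv u) := by
  obtain ⟨g, hg, hg'⟩ := h
  rwa [hg.weakDeriv_eq]

theorem MemH1.add {ℓ : ℝ} {u v : EdgeL2 ℓ} (hu : MemH1 u) (hv : MemH1 v) : MemH1 (u + v) :=
  ⟨_, hu.isWeakDeriv.add hv.isWeakDeriv⟩

theorem MemH1.smul {ℓ : ℝ} {u : EdgeL2 ℓ} (z : ℂ) (hu : MemH1 u) : MemH1 (z • u) :=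
  ⟨_, hu.isWeakDeriv.smul z⟩

theorem MemH1.weakDeriv_add {ℓ : ℝ} {u v : EdgeL2 ℓ} (hu : MemH1 u) (hv : MemH1 v) :
    weakDeriv (u + v) = weakDeriv u + weakDeriv v :=
  (hu.isWeakDeriv.add hv.isWeakDeriv).weakDeriv_eq

theorem MemH1.weakDeriv_smul {ℓ : ℝ} {u : EdgeL2 ℓ} (z : ℂ) (hu : MemH1 u) :
    weakDeriv (z • u) = z • weakDeriv u :=
  (hu.isWeakDeriv.smul z).weakDeriv_eq

theorem MemH2.add {ℓ : ℝ} {u v : EdgeL2 ℓ} (hu : MemH2 u) (hv : MemH2 v) : MemH2 (u + v) :=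
  ⟨_, hu.memH1.isWeakDeriv.add hv.memH1.isWeakDeriv, hu.memH1_weakDeriv.add hv.memH1_weakDeriv⟩

theorem MemH2.smul {ℓ : ℝ} {u : EdgeL2 ℓ} (z : ℂ) (hu : MemH2 u) : MemH2 (z • u) :=
  ⟨_, hu.memH1.isWeakDeriv.smul z, hu.memH1_weakDeriv.smul z⟩

theorem MemH2.zero {ℓ : ℝ} : MemH2 (0 : EdgeL2 ℓ) :=
  ⟨0, IsWeakDeriv.zero, 0, IsWeakDeriv.zero⟩

/-! ### Vertex conditions -/

/-- Data of a vertex condition on `ℂ^ι`: orthogonal projections `PD`, `PN`, `PR` (Dirichlet, Neumann,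
Robin part) with mutually orthogonal ranges that add up to the identity, and an operator `Λ` in the
range of `PR`. -/
structure VertexCondition (ι : Type*) [Fintype ι] where
  PD : EuclideanSpace ℂ ι →L[ℂ] EuclideanSpace ℂ ι
  PN : EuclideanSpace ℂ ι →L[ℂ] EuclideanSpace ℂ ι
  PR : EuclideanSpace ℂ ι →L[ℂ] EuclideanSpace ℂ ι
  isProj_D : IsStarProjection PD
  isProj_N : IsStarProjection PN
  isProj_R : IsStarProjection PR
  ortho_DN : PD.range ⟂ PN.range
  ortho_DR : PD.range ⟂ PR.range
  ortho_NR : PN.range ⟂ PR.range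
  sum_eq_one : PD + PN + PR = 1
  Λ : PR.range →L[ℂ] PR.range

namespace VertexCondition

variable {ι : Type*} [Fintype ι]

/-- The condition is of the self-adjoint type: `Λ` is self-adjoint and invertible. -/
def IsSelfAdjointCondition (c : VertexCondition ι) : Prop :=
  LinearMap.IsSymmetric (𝕜 := ℂ) (E := c.PR.range) c.Λ ∧ IsUnit c.Λ

/-- The condition with the same projections and with `Λ` replaced by `Λ'`. -/
def withRobin (c : VertexCondition ι) (Λ' : c.PR.range →L[ℂ] c.PR.range) : VertexCondition ι :=
  { c with Λ := Λ' }

/-- `PR x` as an element of the range of `PR`. -/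
def robinPart (c : VertexCondition ι) : EuclideanSpace ℂ ι →ₗ[ℂ] c.PR.range :=
  c.PR.toLinearMap.rangeRestrict

/-- The boundary values `F` and the boundary derivatives `F'` satisfy the vertex condition. -/
def Holds (c : VertexCondition ι) (F F' : EuclideanSpace ℂ ι) : Prop :=
  c.PD F = 0 ∧ c.PN F' = 0 ∧ c.robinPart F' = c.Λ (c.robinPart F)

/-- The line in `ℂ^ι` spanned by `(1, …, 1)`. -/
def onesLine (ι : Type*) [Fintype ι] : Submodule ℂ (EuclideanSpace ℂ ι) :=
  Submodule.span ℂ {WithLp.toLp 2 fun _ => (1 : ℂ)}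

/-- The `δ` coupling condition of strength `α`. -/
def delta (ι : Type*) [Fintype ι] (α : ℝ) : VertexCondition ι where
  PD := (onesLine ι)ᗮ.starProjection
  PN := 0
  PR := (onesLine ι).starProjection
  isProj_D := isStarProjection_starProjection
  isProj_N := IsStarProjection.zero _
  isProj_R := isStarProjection_starProjection
  ortho_DN := by simp
  ortho_DR := by simp
  ortho_NR := by simp
  sum_eq_one := by rw [Submodule.starProjection_orthogonal']; abel
  Λ := ((α / Fintype.card ι : ℝ) : ℂ) • 1

/-- The `δ'` coupling condition of strength `β` (used for `β ≠ 0`). -/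
def deltaPrime (ι : Type*) [Fintype ι] (β : ℝ) : VertexCondition ι where
  PD := 0
  PN := (onesLine ι)ᗮ.starProjection
  PR := (onesLine ι).starProjection
  isProj_D := IsStarProjection.zero _
  isProj_N := isStarProjection_starProjection
  isProj_R := isStarProjection_starProjection
  ortho_DN := by simp
  ortho_DR := by simp
  ortho_NR := by simp
  sum_eq_one := by rw [Submodule.starProjection_orthogonal']; abel
  Λ := ((Fintype.card ι / β : ℝ) : ℂ) • 1

end VertexCondition

/-! ### Metric graphs and Schrödinger operators -/

/-- A metric graph with vertices `V` and edges `E` (loops and parallel edges allowed): edge `e` is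
the interval `[0, L e]`, its endpoint `0` being the vertex `o e` and its endpoint `L e` the vertex
`t e`. It is compact when `V` and `E` are finite. -/
structure MetricGraph (V E : Type*) where
  o : E → V
  t : E → V
  L : E → ℝ
  L_pos : ∀ e, 0 < L e

namespace MetricGraph

variable {V E : Type*} [Fintype E] (G : MetricGraph V E)

/-- The edge ends at the vertex `v`: the pair `(e, false)` is the origin of `e`, the pair `(e, true)`
its terminal end. A loop at `v` contributes both of its ends. -/
abbrev Ends (v : V) : Type _ := {p : E × Bool // (if p.2 then G.t p.1 else G.o p.1) = v}

/-- The degree of a vertex. -/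
def deg [DecidableEq V] (v : V) : ℕ := Fintype.card (G.Ends v)

/-- `L²(Γ)`, the Hilbert space direct sum of the spaces `L²(0, L e)`. -/
abbrev L2 {V E : Type*} [Fintype E] (G : MetricGraph V E) := PiLp 2 fun e : E => EdgeL2 (G.L e)

/-- `L^∞(Γ)`, real-valued. -/
abbrev Potential {V E : Type*} (G : MetricGraph V E) := ∀ e : E, Lp ℝ ∞ (edgeMeasure (G.L e))

/-- The coordinate of an edge end on its edge. -/
def endCoord {V E : Type*} (G : MetricGraph V E) (p : E × Bool) : ℝ := if p.2 then G.L p.1 else 0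

/-- The vector `F(v)` of boundary values at `v` (for `f` in `H¹` on each edge). -/
def bdryValue (f : G.L2) (v : V) : EuclideanSpace ℂ (G.Ends v) :=
  WithLp.toLp 2 fun p => contRep (f p.1.1) (G.endCoord p.1)

/-- The vector `F'(v)` of derivatives at `v`, pointing out of `v` into the edges (for `f` in `H²` on
each edge). -/
def bdryDeriv (f : G.L2) (v : V) : EuclideanSpace ℂ (G.Ends v) :=
  WithLp.toLp 2 fun p =>
    (if p.1.2 then -1 else 1 : ℂ) * contRep (weakDeriv (f p.1.1)) (G.endCoord p.1)

/-- The edgewise weak derivative. -/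
def grad {V E : Type*} [Fintype E] (G : MetricGraph V E) (f : G.L2) : G.L2 :=
  WithLp.toLp 2 fun e => weakDeriv (f e)

theorem endCoord_mem {V E : Type*} (G : MetricGraph V E) (p : E × Bool) :
    G.endCoord p ∈ Icc 0 (G.L p.1) := by
  unfold endCoord
  split
  · exact ⟨(G.L_pos _).le, le_rfl⟩
  · exact ⟨le_rfl, (G.L_pos _).le⟩

theorem bdryValue_add {f g : G.L2} (hf : ∀ e, MemH2 (f e)) (hg : ∀ e, MemH2 (g e)) (v : V) :
    G.bdryValue (f + g) v = G.bdryValue f v + G.bdryValue g v := by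
  ext p
  exact (hf p.1.1).memH1.contRep_add (G.L_pos _) (hg p.1.1).memH1 (G.endCoord_mem p.1)

theorem bdryValue_smul {f : G.L2} (z : ℂ) (hf : ∀ e, MemH2 (f e)) (v : V) :
    G.bdryValue (z • f) v = z • G.bdryValue f v := by
  ext p
  exact (hf p.1.1).memH1.contRep_smul (G.L_pos _) z (G.endCoord_mem p.1)

theorem bdryDeriv_add {f g : G.L2} (hf : ∀ e, MemH2 (f e)) (hg : ∀ e, MemH2 (g e)) (v : V) :
    G.bdryDeriv (f + g) v = G.bdryDeriv f v + G.bdryDeriv g v := by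
  ext p
  have h1 : weakDeriv ((f + g) p.1.1) = weakDeriv (f p.1.1) + weakDeriv (g p.1.1) :=
    (hf p.1.1).memH1.weakDeriv_add (hg p.1.1).memH1
  have h2 := (hf p.1.1).memH1_weakDeriv.contRep_add (G.L_pos _) (hg p.1.1).memH1_weakDeriv
    (G.endCoord_mem p.1)
  simp only [bdryDeriv, PiLp.add_apply] at h1 ⊢
  rw [h1, h2, Pi.add_apply, mul_add]

theorem bdryDeriv_smul {f : G.L2} (z : ℂ) (hf : ∀ e, MemH2 (f e)) (v : V) :
    G.bdryDeriv (z • f) v = z • G.bdryDeriv f v := by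
  ext p
  have h1 : weakDeriv ((z • f) p.1.1) = z • weakDeriv (f p.1.1) :=
    (hf p.1.1).memH1.weakDeriv_smul z
  have h2 := (hf p.1.1).memH1_weakDeriv.contRep_smul (G.L_pos _) z (G.endCoord_mem p.1)
  simp only [bdryDeriv, PiLp.smul_apply] at h1 ⊢
  rw [h1, h2, Pi.smul_apply, smul_eq_mul, smul_eq_mul]
  ring

/-- The domain of the Schrödinger operator: functions in `H²` on each edge that satisfy the vertex
condition at each vertex. -/
def hamiltonianDomain [DecidableEq V] (C : ∀ v, VertexCondition (G.Ends v)) : Submodule ℂ G.L2 where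
  carrier := {f | (∀ e, MemH2 (f e)) ∧ ∀ v, (C v).Holds (G.bdryValue f v) (G.bdryDeriv f v)}
  add_mem' := by
    rintro f g ⟨hf, hf'⟩ ⟨hg, hg'⟩
    refine ⟨fun e => (hf e).add (hg e), fun v => ?_⟩
    obtain ⟨a1, a2, a3⟩ := hf' v
    obtain ⟨b1, b2, b3⟩ := hg' v
    rw [G.bdryValue_add hf hg, G.bdryDeriv_add hf hg]
    refine ⟨?_, ?_, ?_⟩
    · rw [map_add, a1, b1, add_zero]
    · rw [map_add, a2, b2, add_zero]
    · rw [map_add, map_add, map_add, a3, b3]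
  zero_mem' := by
    have hz : ∀ e : E, MemH2 ((0 : G.L2) e) := fun _ => MemH2.zero
    refine ⟨hz, fun v => ?_⟩
    have h1 := G.bdryValue_smul 0 hz v
    have h2 := G.bdryDeriv_smul 0 hz v
    rw [zero_smul, zero_smul] at h1 h2
    rw [h1, h2]
    exact ⟨map_zero _, map_zero _, by rw [map_zero, map_zero]⟩
  smul_mem' := by
    rintro z f ⟨hf, hf'⟩
    refine ⟨fun e => (hf e).smul z, fun v => ?_⟩
    obtain ⟨a1, a2, a3⟩ := hf' v
    rw [G.bdryValue_smul z hf, G.bdryDeriv_smul z hf]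
    refine ⟨?_, ?_, ?_⟩
    · rw [map_smul, a1, smul_zero]
    · rw [map_smul, a2, smul_zero]
    · rw [map_smul, map_smul, map_smul, a3]

/-- The Schrödinger operator `(H f)_e = - f_e'' + q_e f_e` with potential `q` and vertex
conditions `C`, as an unbounded operator in `L²(Γ)`. -/
def hamiltonian [DecidableEq V] (q : G.Potential) (C : ∀ v, VertexCondition (G.Ends v)) :
    G.L2 →ₗ.[ℂ] G.L2 where
  domain := G.hamiltonianDomain C
  toFun :=
    { toFun := fun f => WithLp.toLp 2 fun e =>
        - weakDeriv (weakDeriv (f.1 e)) + (q e • f.1 e : EdgeL2 (G.L e))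
      map_add' := by
        rintro ⟨f, hf⟩ ⟨g, hg⟩
        ext1 e
        change - weakDeriv (weakDeriv (f e + g e)) + (q e • (f e + g e) : EdgeL2 (G.L e)) =
          (- weakDeriv (weakDeriv (f e)) + (q e • f e : EdgeL2 (G.L e))) +
          (- weakDeriv (weakDeriv (g e)) + (q e • g e : EdgeL2 (G.L e)))
        rw [(hf.1 e).memH1.weakDeriv_add (hg.1 e).memH1,
          (hf.1 e).memH1_weakDeriv.weakDeriv_add (hg.1 e).memH1_weakDeriv, Lp.add_smul]
        abel
      map_smul' := by
        rintro z ⟨f, hf⟩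
        ext1 e
        change - weakDeriv (weakDeriv (z • f e)) + (q e • (z • f e) : EdgeL2 (G.L e)) =
          z • (- weakDeriv (weakDeriv (f e)) + (q e • f e : EdgeL2 (G.L e)))
        have hq : (q e • (z • f e) : EdgeL2 (G.L e)) = z • (q e • f e : EdgeL2 (G.L e)) := by
          refine Lp.ext ?_
          filter_upwards [Lp.coeFn_lpSMul (r := 2) (q e) (z • f e), Lp.coeFn_smul z (f e),
            Lp.coeFn_smul z (q e • f e : EdgeL2 (G.L e)),
            Lp.coeFn_lpSMul (r := 2) (q e) (f e)] with x h1 h2 h3 h4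
          rw [h1, h3, Pi.smul_apply', h2, Pi.smul_apply, Pi.smul_apply, h4, Pi.smul_apply',
            smul_comm]
        rw [(hf.1 e).memH1.weakDeriv_smul z, (hf.1 e).memH1_weakDeriv.weakDeriv_smul z, smul_add,
          smul_neg, hq] }

end MetricGraph

/-! ### Eigenvalues of unbounded operators and branches of simple eigenvalues -/

/-- The eigenspace `ker (A - μ)` of an unbounded operator `A`. -/
def eigenspaceOf {X : Type*} [AddCommGroup X] [Module ℂ X] (A : X →ₗ.[ℂ] X) (μ : ℂ) :
    Submodule ℂ X :=
  (LinearMap.ker (A.toFun - μ • A.domain.subtype)).map A.domain.subtype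

/-- `μ` is a simple eigenvalue of `A`: the eigenspace has dimension one. -/
def IsSimpleEigenvalue {X : Type*} [AddCommGroup X] [Module ℂ X] (A : X →ₗ.[ℂ] X) (μ : ℂ) : Prop :=
  Module.finrank ℂ (eigenspaceOf A μ) = 1

/-- Let `A x` be operators in `L²(Γ)` that depend on a parameter `x` in a normed space, and let `μ₀`
be an eigenvalue of `A x₀` with eigenfunction `f₀`. The predicate says that on the open neighbourhood
`U` of `x₀` the maps `μ` and `f` are the eigenvalue and a choice of a normalized eigenfunction of
`A x` that continue `μ₀` and `f₀`: `μ x` is a simple eigenvalue, it is the only eigenvalue of `A x`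
within a fixed distance of `μ₀`, and `f` is differentiable on `U` as a map into the Sobolev space
`H¹` of the graph (both `f x` and its edgewise derivative are differentiable in `L²(Γ)`). -/
structure IsEigenBranch {V E : Type*} [Fintype E] {G : MetricGraph V E} {P : Type*}
    [NormedAddCommGroup P] [NormedSpace ℝ P] (A : P → (G.L2 →ₗ.[ℂ] G.L2)) (U : Set P) (x₀ : P)
    (μ₀ : ℂ) (f₀ : G.L2) (μ : P → ℂ) (f : P → G.L2) : Prop where
  isOpen : IsOpen U
  mem : x₀ ∈ U
  value_base : μ x₀ = μ₀
  function_base : f x₀ = f₀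
  simple : ∀ x ∈ U, IsSimpleEigenvalue (A x) (μ x)
  isolated : ∃ ε > 0, ∀ x ∈ U, ∀ ν : ℂ, ‖ν - μ₀‖ < ε → eigenspaceOf (A x) ν ≠ ⊥ → ν = μ x
  eigen : ∀ x ∈ U, f x ∈ eigenspaceOf (A x) (μ x)
  normalized : ∀ x ∈ U, ‖f x‖ = 1
  differentiable : DifferentiableOn ℝ f U
  differentiable_grad : DifferentiableOn ℝ (fun x => G.grad (f x)) U

end

noncomputable section

/-! ### The primitive operator on an interval -/

/-! The eigenvalue problem is rewritten as a parameter-dependent equation between bounded operators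
on one fixed Banach space, and the simple eigenvalue is continued by the implicit function theorem.
No self-adjointness of the perturbed operators is needed.

A function in `H²` on each edge is determined by its second derivative `h` and two integration
constants per edge. In these data (`H2Data`) the function, its gradient, the expression `-f'' + q f`
and all boundary vectors are bounded linear maps. At each vertex the three conditions take values in
orthogonal subspaces, so together they are the kernel of one map. An eigenfunction is then a
solution of `A x = l J x`, `B x = 0`, where a change `T` of the Robin operator at `v₀` changes only
`B`, and does so linearly.

At an eigenpair `(l₀, x₀)` consider the bordered operator `(x, t) ↦ (A x - l J x - t J x₀, B x, ⟨J
x₀, J x⟩)`. For simple `l₀` it is bijective (`MetricGraph.bijective_borderedOp`). Green's formula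
and symmetry of the conditions force `t = 0` on the kernel, and simplicity then forces `x = 0`.
Surjectivity follows from a dimension count: the block acting on `h` is minus the identity plus a
quasi-nilpotent Volterra operator (`isUnit_one_sub_edgePrim_sq`), and there are as many vertex
conditions as integration constants.

Bijectivity persists for `(T, l)` near `(0, l₀)`. Let `(x, t)` be the preimage of `(0, 0, 1)`; near
the base point `l` is an eigenvalue exactly when `t = 0`. Green's formula computes `t = l₀ - l + ⟨R
x₀, T R x⟩`, with `R` the Robin part of the boundary values at `v₀`. The `l`-derivative at the base
point is `-1`, so `t = 0` is solved by a differentiable `l(T)` with derivative `T ↦ ⟨R x₀, T R x₀⟩`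
(`exists_eigenpair_continuation`).

The `δ` and `δ'` conditions are scalar Robin operators `α / d` and `d / β` on the line of constant
vectors. There `‖R x₀‖² = |∑ F_j|² / d`, and the chain rule gives the two remaining formulas. -/

theorem edge_integral_norm_le {ℓ : ℝ} (u : EdgeL2 ℓ) :
    ∫ x in Ioo 0 ℓ, ‖u x‖ ≤ (edgeMeasure ℓ univ).toReal ^ (1 / 2 : ℝ) * ‖u‖ := by
  have h1 := eLpNorm_le_eLpNorm_mul_rpow_measure_univ (μ := edgeMeasure ℓ) (p := 1) (q := 2)
    (f := u) (by norm_num) (Lp.aestronglyMeasurable u)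
  have h2 : ∫ x in Ioo 0 ℓ, ‖u x‖ = (eLpNorm u 1 (edgeMeasure ℓ)).toReal := by
    rw [eLpNorm_one_eq_lintegral_enorm, integral_norm_eq_lintegral_enorm
      (Lp.aestronglyMeasurable u)]
  have h3 : (1 / (1 : ℝ≥0∞).toReal - 1 / (2 : ℝ≥0∞).toReal) = (1 / 2 : ℝ) := by norm_num
  rw [h3] at h1
  rw [h2, Lp.norm_def, mul_comm, ENNReal.toReal_rpow, ← ENNReal.toReal_mul]
  refine ENNReal.toReal_mono (ENNReal.mul_ne_top (Lp.eLpNorm_ne_top u) ?_) h1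
  exact ENNReal.rpow_ne_top_of_nonneg (by norm_num) (measure_ne_top _ _)

theorem edge_intervalIntegrable {ℓ : ℝ} (u : EdgeL2 ℓ) {x : ℝ} (hx : x ∈ Icc 0 ℓ) :
    IntervalIntegrable u volume 0 x := by
  rw [intervalIntegrable_iff_integrableOn_Ioo_of_le hx.1]
  exact (edge_integrable u).mono_measure (Measure.restrict_mono (Ioo_subset_Ioo_right hx.2) le_rfl)

/-- Cauchy–Schwarz against the constant function; the factor is `√ℓ` for `ℓ ≥ 0`. The bound holds at
every point, so one integration passes from an `L²` norm to a pointwise estimate. -/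
theorem edge_norm_primitive_le {ℓ : ℝ} (u : EdgeL2 ℓ) {x : ℝ} (hx : x ∈ Icc 0 ℓ) :
    ‖∫ y in (0 : ℝ)..x, u y‖ ≤ (edgeMeasure ℓ univ).toReal ^ (1 / 2 : ℝ) * ‖u‖ := by
  refine le_trans ?_ (edge_integral_norm_le u)
  rw [intervalIntegral.integral_of_le hx.1, integral_Ioc_eq_integral_Ioo]
  refine (norm_integral_le_integral_norm _).trans ?_
  exact setIntegral_mono_set (edge_integrable u).norm (Filter.Eventually.of_forall fun _ =>
    norm_nonneg _) (Ioo_subset_Ioo_right hx.2).eventuallyLE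

theorem edge_continuousOn_primitive {ℓ : ℝ} (g : EdgeL2 ℓ) :
    ContinuousOn (fun x => ∫ y in (0 : ℝ)..x, g y) (Icc 0 ℓ) := by
  rcases le_or_gt 0 ℓ with hℓ | hℓ
  · have := intervalIntegral.continuousOn_primitive_interval (μ := volume) (f := g)
      (a := 0) (b := ℓ) (by
        rw [uIcc_of_le hℓ, integrableOn_Icc_iff_integrableOn_Ioo]
        exact edge_integrable g)
    rwa [uIcc_of_le hℓ] at this
  · simp [Icc_eq_empty (not_le.2 hℓ)]

theorem edge_memLp_primitive {ℓ : ℝ} (u : EdgeL2 ℓ) :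
    MemLp (fun x => ∫ y in (0 : ℝ)..x, u y) 2 (edgeMeasure ℓ) := by
  refine MemLp.of_bound (((edge_continuousOn_primitive u).mono
    Ioo_subset_Icc_self).aestronglyMeasurable measurableSet_Ioo)
    ((edgeMeasure ℓ univ).toReal ^ (1 / 2 : ℝ) * ‖u‖) ?_
  filter_upwards [ae_restrict_mem measurableSet_Ioo] with x hx
  exact edge_norm_primitive_le u (Ioo_subset_Icc_self hx)

theorem edge_norm_le_of_ae_bound {ℓ : ℝ} {u : EdgeL2 ℓ} {K : ℝ} (hK : 0 ≤ K)
    (h : ∀ᵐ x ∂edgeMeasure ℓ, ‖u x‖ ≤ K) :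
    ‖u‖ ≤ (edgeMeasure ℓ univ).toReal ^ (1 / 2 : ℝ) * K := by
  refine (Lp.norm_le_of_ae_bound hK h).trans_eq ?_
  rw [measureUnivNNReal, ENNReal.coe_toNNReal_eq_toReal]
  norm_num

/-- The operator `u ↦ ∫₀ˣ u` in `L²(0, ℓ)`. -/
def edgePrim (ℓ : ℝ) : EdgeL2 ℓ →L[ℂ] EdgeL2 ℓ :=
  LinearMap.mkContinuous
    { toFun := fun u => (edge_memLp_primitive u).toLp _
      map_add' := by
        intro u v
        refine Lp.ext ?_
        filter_upwards [(edge_memLp_primitive (u + v)).coeFn_toLp,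
          Lp.coeFn_add ((edge_memLp_primitive u).toLp _) ((edge_memLp_primitive v).toLp _),
          (edge_memLp_primitive u).coeFn_toLp, (edge_memLp_primitive v).coeFn_toLp,
          ae_restrict_mem measurableSet_Ioo] with x h1 h2 h3 h4 hx
        have hx' := Ioo_subset_Icc_self hx
        rw [h1, h2, Pi.add_apply, h3, h4, ← intervalIntegral.integral_add
          (edge_intervalIntegrable u hx') (edge_intervalIntegrable v hx')]
        refine intervalIntegral.integral_congr_ae_restrict ?_
        rw [uIoc_of_le hx.1.le, ← restrict_Ioo_eq_restrict_Ioc]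
        exact ae_mono (Measure.restrict_mono (Ioo_subset_Ioo_right hx'.2) le_rfl)
          (Lp.coeFn_add u v)
      map_smul' := by
        intro z u
        refine Lp.ext ?_
        filter_upwards [(edge_memLp_primitive (z • u)).coeFn_toLp,
          Lp.coeFn_smul z ((edge_memLp_primitive u).toLp _),
          (edge_memLp_primitive u).coeFn_toLp,
          ae_restrict_mem measurableSet_Ioo] with x h1 h2 h3 hx
        rw [h1, RingHom.id_apply, h2, Pi.smul_apply, h3, ← intervalIntegral.integral_smul]
        refine intervalIntegral.integral_congr_ae_restrict ?_
        rw [uIoc_of_le hx.1.le, ← restrict_Ioo_eq_restrict_Ioc]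
        exact ae_mono (Measure.restrict_mono (Ioo_subset_Ioo_right hx.2.le) le_rfl)
          (Lp.coeFn_smul z u) }
    ((edgeMeasure ℓ univ).toReal ^ (1 / 2 : ℝ) * (edgeMeasure ℓ univ).toReal ^ (1 / 2 : ℝ)) (by
      intro u
      have hC : 0 ≤ (edgeMeasure ℓ univ).toReal ^ (1 / 2 : ℝ) * ‖u‖ := by positivity
      rw [mul_assoc]
      refine edge_norm_le_of_ae_bound hC ?_
      filter_upwards [(edge_memLp_primitive u).coeFn_toLp,
        ae_restrict_mem measurableSet_Ioo] with x h1 hx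
      rw [LinearMap.coe_mk, AddHom.coe_mk, h1]
      exact edge_norm_primitive_le u (Ioo_subset_Icc_self hx))

theorem coeFn_edgePrim {ℓ : ℝ} (u : EdgeL2 ℓ) :
    edgePrim ℓ u =ᵐ[edgeMeasure ℓ] fun x => ∫ y in (0 : ℝ)..x, u y :=
  (edge_memLp_primitive u).coeFn_toLp

/-- The constant functions in `L²(0, ℓ)`. -/
def edgeConst (ℓ : ℝ) : ℂ →L[ℂ] EdgeL2 ℓ := Lp.constL 2 (edgeMeasure ℓ) ℂ

theorem coeFn_edgeConst {ℓ : ℝ} (c : ℂ) : edgeConst ℓ c =ᵐ[edgeMeasure ℓ] fun _ => c :=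
  Lp.coeFn_const (p := 2) (μ := edgeMeasure ℓ) c

/-- The functional `u ↦ ∫₀ˡ u` on `L²(0, ℓ)`. -/
def edgeInt (ℓ : ℝ) : EdgeL2 ℓ →L[ℂ] ℂ := innerSL ℂ (edgeConst ℓ 1)

theorem edgeInt_apply {ℓ : ℝ} (hℓ : 0 ≤ ℓ) (u : EdgeL2 ℓ) :
    edgeInt ℓ u = ∫ y in (0 : ℝ)..ℓ, u y := by
  rw [edgeInt, innerSL_apply_apply, L2.inner_def, intervalIntegral.integral_of_le hℓ,
    integral_Ioc_eq_integral_Ioo]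
  refine integral_congr_ae ?_
  filter_upwards [coeFn_edgeConst (ℓ := ℓ) 1] with x hx
  simp [hx]

/-- Against a constant, `φ'` integrates to `φ(ℓ) - φ(0) = 0`; the primitive is handled by Fubini in
`edge_primitive_weakDeriv`. Together with the converse below this identifies `H¹(0, ℓ)` with pairs
of a constant and an `L²` derivative. -/
theorem isWeakDeriv_edgeConst_add_edgePrim {ℓ : ℝ} (hℓ : 0 < ℓ) (c : ℂ) (g : EdgeL2 ℓ) :
    IsWeakDeriv (edgeConst ℓ c + edgePrim ℓ g) g := by
  have h1 : IsWeakDeriv (edgeConst ℓ c) 0 := by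
    intro φ a b s
    have e1 : ∫ x in Ioo 0 ℓ, φ x • (0 : EdgeL2 ℓ) x = ∫ x in Ioo 0 ℓ, (0 : ℂ) := by
      refine integral_congr_ae ?_
      filter_upwards [Lp.coeFn_zero ℂ 2 (edgeMeasure ℓ)] with x hx
      rw [hx, Pi.zero_apply, smul_zero]
    have e2 : ∫ x in Ioo 0 ℓ, deriv φ x • edgeConst ℓ c x = ∫ x in Ioo 0 ℓ, deriv φ x • c := by
      refine integral_congr_ae ?_
      filter_upwards [coeFn_edgeConst (ℓ := ℓ) c] with x hx
      rw [hx]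
    rw [e1, e2, integral_zero, neg_zero, integral_smul_const, ← integral_Ioc_eq_integral_Ioo,
      ← intervalIntegral.integral_of_le hℓ.le, intervalIntegral.integral_deriv_eq_sub
        (fun x _ => (a.differentiable (by simp)).differentiableAt)
        ((a.continuous_deriv (by simp)).intervalIntegrable _ _),
      image_eq_zero_of_notMem_tsupport fun h => lt_irrefl _ (s h).2,
      image_eq_zero_of_notMem_tsupport fun h => lt_irrefl _ (s h).1, sub_zero, zero_smul]
  have h2 : IsWeakDeriv (edgePrim ℓ g) g := by
    intro φ a b s
    rw [← edge_primitive_weakDeriv g a b s]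
    refine integral_congr_ae ?_
    filter_upwards [coeFn_edgePrim g] with x hx
    rw [hx]
  simpa using h1.add h2

theorem IsWeakDeriv.exists_eq_edgeConst_add_edgePrim {ℓ : ℝ} (hℓ : 0 < ℓ) {u g : EdgeL2 ℓ}
    (h : IsWeakDeriv u g) : ∃ c : ℂ, u = edgeConst ℓ c + edgePrim ℓ g := by
  obtain ⟨c, hc⟩ := h.isContRep hℓ
  refine ⟨c, Lp.ext ?_⟩
  filter_upwards [hc.2, Lp.coeFn_add (edgeConst ℓ c) (edgePrim ℓ g), coeFn_edgeConst (ℓ := ℓ) c,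
    coeFn_edgePrim g] with x h1 h2 h3 h4
  rw [h1, h2, Pi.add_apply, h3, h4]

theorem contRep_edgeConst_add_edgePrim {ℓ : ℝ} (hℓ : 0 < ℓ) (c : ℂ) (g : EdgeL2 ℓ) :
    EqOn (contRep (edgeConst ℓ c + edgePrim ℓ g)) (fun x => c + ∫ y in (0 : ℝ)..x, g y)
      (Icc 0 ℓ) := by
  refine IsContRep.contRep_eqOn hℓ ⟨continuousOn_const.add (edge_continuousOn_primitive g), ?_⟩
  filter_upwards [Lp.coeFn_add (edgeConst ℓ c) (edgePrim ℓ g), coeFn_edgeConst (ℓ := ℓ) c,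
    coeFn_edgePrim g] with x h2 h3 h4
  rw [h2, Pi.add_apply, h3, h4]

/-- Integration by parts for the primitive operator. -/
theorem inner_edgePrim_add_inner_edgePrim {ℓ : ℝ} (hℓ : 0 ≤ ℓ) (g h : EdgeL2 ℓ) :
    inner ℂ (edgePrim ℓ g) h + inner ℂ g (edgePrim ℓ h)
      = starRingEnd ℂ (edgeInt ℓ g) * edgeInt ℓ h := by
  have ig : Integrable (fun x => starRingEnd ℂ (g x)) (edgeMeasure ℓ) :=
    ContinuousLinearMap.integrable_comp Complex.conjCLE.toContinuousLinearMap (edge_integrable g)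
  have i0 : Integrable (fun p : ℝ × ℝ => starRingEnd ℂ (g p.1) * h p.2)
      ((edgeMeasure ℓ).prod (edgeMeasure ℓ)) := ig.mul_prod (edge_integrable h)
  have hS : MeasurableSet {p : ℝ × ℝ | p.2 < p.1} := measurableSet_lt measurable_snd measurable_fst
  -- The two inner products are the integrals of `conj (g x) * h y` over the triangle `y < x` and
  -- over its complement in the square, so their sum is a product of two one-dimensional integrals.
  have e1 : inner ℂ g (edgePrim ℓ h) = ∫ p in {p : ℝ × ℝ | p.2 < p.1},
      starRingEnd ℂ (g p.1) * h p.2 ∂((edgeMeasure ℓ).prod (edgeMeasure ℓ)) := by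
    rw [← integral_indicator hS, integral_prod _ (i0.indicator hS), L2.inner_def]
    refine integral_congr_ae ?_
    filter_upwards [coeFn_edgePrim h, ae_restrict_mem measurableSet_Ioo] with x hx hm
    have : ∀ y, {p : ℝ × ℝ | p.2 < p.1}.indicator (fun p => starRingEnd ℂ (g p.1) * h p.2) (x, y)
        = (Iio x).indicator (fun y => starRingEnd ℂ (g x) * h y) y := fun y => by
      simp [indicator]
    simp only [this]
    have hI : Ioo 0 ℓ ∩ Iio x = Ioo 0 x := by
      ext y
      simp only [mem_Ioo, mem_inter_iff, mem_Iio]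
      exact ⟨fun h => ⟨h.1.1, h.2⟩, fun h => ⟨⟨h.1, h.2.trans hm.2⟩, h.2⟩⟩
    rw [setIntegral_indicator measurableSet_Iio, hI, integral_const_mul, hx,
      intervalIntegral.integral_of_le hm.1.le, integral_Ioc_eq_integral_Ioo, RCLike.inner_apply,
      mul_comm]
  have e2 : inner ℂ (edgePrim ℓ g) h = ∫ p in {p : ℝ × ℝ | p.2 < p.1}ᶜ,
      starRingEnd ℂ (g p.1) * h p.2 ∂((edgeMeasure ℓ).prod (edgeMeasure ℓ)) := by
    rw [← integral_indicator hS.compl, integral_prod_symm _ (i0.indicator hS.compl), L2.inner_def]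
    refine integral_congr_ae ?_
    filter_upwards [coeFn_edgePrim g, ae_restrict_mem measurableSet_Ioo] with y hy hm
    have : ∀ x, {p : ℝ × ℝ | p.2 < p.1}ᶜ.indicator (fun p => starRingEnd ℂ (g p.1) * h p.2) (x, y)
        = (Iic y).indicator (fun x => starRingEnd ℂ (g x) * h y) x := fun x => by
      simp [indicator]
    simp only [this]
    have hI : Ioo 0 ℓ ∩ Iic y = Ioc 0 y := by
      ext x
      simp only [mem_Ioo, mem_Ioc, mem_inter_iff, mem_Iic]
      exact ⟨fun h => ⟨h.1.1, h.2⟩, fun h => ⟨⟨h.1, h.2.trans_lt hm.2⟩, h.2⟩⟩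
    rw [setIntegral_indicator measurableSet_Iic, hI, integral_mul_const, hy,
      intervalIntegral.integral_of_le hm.1.le, integral_conj, RCLike.inner_apply, mul_comm]
  rw [e1, e2, add_comm, integral_add_compl hS i0,
    integral_prod_mul (fun x => starRingEnd ℂ (g x)) (fun y => h y), edgeInt_apply hℓ,
    edgeInt_apply hℓ, intervalIntegral.integral_of_le hℓ, integral_Ioc_eq_integral_Ioo,
    intervalIntegral.integral_of_le hℓ, integral_Ioc_eq_integral_Ioo, integral_conj]

/-! ### Volterra operators -/

/-- The monomial bound is integrated from `0` to `x`. Iteration yields the factorial decay behind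
the quasi-nilpotency of Volterra operators. -/
theorem edgePrim_ae_bound {ℓ : ℝ} {w : EdgeL2 ℓ} {K : ℝ} {n : ℕ}
    (h : ∀ᵐ x ∂edgeMeasure ℓ, ‖w x‖ ≤ K * (x ^ n / n.factorial)) :
    ∀ᵐ x ∂edgeMeasure ℓ, ‖edgePrim ℓ w x‖ ≤ K * (x ^ (n + 1) / (n + 1).factorial) := by
  filter_upwards [coeFn_edgePrim w, ae_restrict_mem measurableSet_Ioo] with x hx hm
  rw [hx]
  have h' : ∀ᵐ y ∂volume, y ∈ Ioc 0 x → ‖w y‖ ≤ K * (y ^ n / n.factorial) := by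
    rw [← ae_restrict_iff' measurableSet_Ioc, ← restrict_Ioo_eq_restrict_Ioc]
    exact ae_mono (Measure.restrict_mono (Ioo_subset_Ioo_right hm.2.le) le_rfl) h
  refine (intervalIntegral.norm_integral_le_of_norm_le hm.1.le h'
    (Continuous.intervalIntegrable (by fun_prop) _ _)).trans_eq ?_
  rw [intervalIntegral.integral_const_mul, intervalIntegral.integral_div, integral_pow,
    Nat.factorial_succ]
  push_cast
  field_simp
  simp

/-- A bounded multiple of the square of the primitive operator is quasi-nilpotent. -/
theorem isUnit_one_sub_edgePrim_sq {ℓ : ℝ} (Q : EdgeL2 ℓ →L[ℂ] EdgeL2 ℓ) {M : ℝ}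
    (hQ : ∀ u, ∀ᵐ x ∂edgeMeasure ℓ, ‖Q u x‖ ≤ M * ‖u x‖) (hM : 0 ≤ M) :
    IsUnit (1 - Q * (edgePrim ℓ * edgePrim ℓ)) := by
  set K := Q * (edgePrim ℓ * edgePrim ℓ) with hK
  set c := (edgeMeasure ℓ univ).toReal ^ (1 / 2 : ℝ) with hc
  have hc0 : 0 ≤ c := by positivity
  -- The first factor `K` is spent on turning the `L²` norm of `u` into a pointwise bound; each
  -- further factor integrates twice. Hence the power `n + 1` goes with the exponent `2 * n`.
  have hb : ∀ (n : ℕ) (u : EdgeL2 ℓ), ∀ᵐ x ∂edgeMeasure ℓ, ‖(K ^ (n + 1)) u x‖ ≤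
      (M ^ (n + 1) * (c * ‖edgePrim ℓ‖ * ‖u‖)) * (x ^ (2 * n) / (2 * n).factorial) := by
    intro n
    induction n with
    | zero =>
      intro u
      filter_upwards [hQ (edgePrim ℓ (edgePrim ℓ u)), coeFn_edgePrim (edgePrim ℓ u),
        ae_restrict_mem measurableSet_Ioo] with x h1 h2 hx
      rw [h2] at h1
      have h3 := edge_norm_primitive_le (edgePrim ℓ u) (Ioo_subset_Icc_self hx)
      have h4 := (edgePrim ℓ).le_opNorm u
      simp only [zero_add, pow_one, mul_zero, pow_zero, Nat.factorial_zero, Nat.cast_one, div_one,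
        mul_one]
      refine h1.trans (mul_le_mul_of_nonneg_left (h3.trans ?_) hM)
      rw [mul_assoc]
      exact mul_le_mul_of_nonneg_left h4 hc0
    | succ n ih =>
      intro u
      have h1 := edgePrim_ae_bound (edgePrim_ae_bound (ih u))
      filter_upwards [h1, hQ (edgePrim ℓ (edgePrim ℓ ((K ^ (n + 1)) u)))] with x h2 h3
      have e : (K ^ (n + 1 + 1)) u = Q (edgePrim ℓ (edgePrim ℓ ((K ^ (n + 1)) u))) := by
        rw [pow_succ' K (n + 1)]; rfl
      rw [e]
      refine h3.trans ((mul_le_mul_of_nonneg_left h2 hM).trans_eq ?_)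
      rw [show 2 * (n + 1) = 2 * n + 1 + 1 by ring]
      ring
  -- Here `(2 * n)!` is weakened to `n!`, which makes the bound a multiple of a term of the
  -- exponential series and so tend to zero.
  have hn : ∀ n : ℕ, ‖K ^ (n + 1)‖ ≤ (c * (M * (c * ‖edgePrim ℓ‖))) *
      ((M * ℓ ^ 2) ^ n / n.factorial) := by
    intro n
    refine ContinuousLinearMap.opNorm_le_bound _ (by positivity) fun u => ?_
    have h0 : 0 ≤ (M ^ (n + 1) * (c * ‖edgePrim ℓ‖ * ‖u‖)) * ((ℓ ^ 2) ^ n / n.factorial) := by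
      positivity
    have h := edge_norm_le_of_ae_bound (u := (K ^ (n + 1)) u) h0 (by
      filter_upwards [hb n u, ae_restrict_mem measurableSet_Ioo] with x h1 hx
      refine h1.trans (mul_le_mul_of_nonneg_left ?_ (by positivity))
      rw [pow_mul]
      have hx0 := hx.1.le
      have hx1 := hx.2.le
      gcongr
      omega)
    refine h.trans_eq ?_
    ring
  have ht : Filter.Tendsto (fun n : ℕ => (c * (M * (c * ‖edgePrim ℓ‖))) *
      ((M * ℓ ^ 2) ^ n / n.factorial)) Filter.atTop (nhds 0) := by
    simpa using (FloorSemiring.tendsto_pow_div_factorial_atTop (M * ℓ ^ 2)).const_mul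
      (c * (M * (c * ‖edgePrim ℓ‖)))
  obtain ⟨n, hn1⟩ := (ht.eventually_lt_const one_pos).exists
  -- Some power of `K` has norm below one. Since `1 - K` is a commuting factor of `1 - K ^ (n + 1)`,
  -- it is a unit as well.
  have hu : IsUnit (1 - K ^ (n + 1)) := isUnit_one_sub_of_norm_lt_one ((hn n).trans_lt hn1)
  rw [← mul_neg_geom_sum] at hu
  have hcomm : Commute (1 - K) (∑ i ∈ Finset.range (n + 1), K ^ i) :=
    Commute.sum_right _ _ _ fun i _ => (Commute.one_left _).sub_left (Commute.self_pow K i)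
  exact (hcomm.isUnit_mul_iff.1 hu).1

/-! ### Perturbation of a simple eigenvalue, abstractly -/

/-- A linear map `N × F → N × F'` with bijective `N`-block and `dim F = dim F'` is surjective if it
is injective. -/
theorem surjective_of_injective_of_block {K N F F' : Type*} [Field K] [AddCommGroup N] [Module K N]
    [AddCommGroup F] [Module K F] [AddCommGroup F'] [Module K F'] [FiniteDimensional K F]
    [FiniteDimensional K F'] (hd : Module.finrank K F = Module.finrank K F')
    (T : N × F →ₗ[K] N × F') (hN : Function.Bijective fun n => (T (n, 0)).1)
    (hT : Function.Injective T) : Function.Surjective T := by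
  let e : N ≃ₗ[K] N :=
    LinearEquiv.ofBijective (LinearMap.fst K N F' ∘ₗ T ∘ₗ LinearMap.inl K N F) hN
  have he : ∀ n, e n = (T (n, 0)).1 := fun n => rfl
  -- Block elimination: `k c` is the `N`-component that makes the first output vanish. The map `S`
  -- below is the Schur complement, for which injectivity and surjectivity agree by the dimension
  -- count.
  let k : F →ₗ[K] N := -(e.symm.toLinearMap ∘ₗ LinearMap.fst K N F' ∘ₗ T ∘ₗ LinearMap.inr K N F)
  have hk : ∀ c, (T (k c, c)).1 = 0 := by
    intro c
    have : ((k c, c) : N × F) = (k c, 0) + (0, c) := by simp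
    rw [this, map_add, Prod.fst_add, ← he]
    simp [k]
  let S : F →ₗ[K] F' := LinearMap.snd K N F' ∘ₗ T ∘ₗ (LinearMap.prod k LinearMap.id)
  have hS : ∀ c, S c = (T (k c, c)).2 := fun c => rfl
  have hSi : Function.Injective S := by
    refine (injective_iff_map_eq_zero S).2 fun c hc => ?_
    have h0 : T (k c, c) = 0 := Prod.ext (hk c) (by rw [← hS, hc]; rfl)
    exact congrArg Prod.snd ((injective_iff_map_eq_zero T).1 hT _ h0)
  have hSs := (LinearMap.injective_iff_surjective_of_finrank_eq_finrank hd).1 hSi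
  rintro ⟨y, z⟩
  obtain ⟨c, hc⟩ := hSs (z - (T (e.symm y, 0)).2)
  refine ⟨(e.symm y, 0) + (k c, c), ?_⟩
  rw [map_add]
  refine Prod.ext ?_ ?_
  · rw [Prod.fst_add, hk, ← he, LinearEquiv.apply_symm_apply, add_zero]
  · rw [Prod.snd_add, ← hS, hc, add_sub_cancel]

/-- The bordered operator `(x, t) ↦ (A x - l J x - t j, B x, ⟨j, J x⟩)`. -/
def borderedOp {X H Y : Type*} [NormedAddCommGroup X] [NormedSpace ℂ X]
    [NormedAddCommGroup H] [InnerProductSpace ℂ H] [NormedAddCommGroup Y] [NormedSpace ℂ Y]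
    (J A : X →L[ℂ] H) (B : X →L[ℂ] Y) (j : H) (l : ℂ) : X × ℂ →L[ℂ] H × Y × ℂ :=
  .inl ℂ H (Y × ℂ) ∘L ((A - l • J) ∘L .fst ℂ X ℂ - (ContinuousLinearMap.snd ℂ X ℂ).smulRight j) +
  .inr ℂ H (Y × ℂ) ∘L (.inl ℂ Y ℂ ∘L B ∘L .fst ℂ X ℂ +
    .inr ℂ Y ℂ ∘L innerSL ℂ j ∘L J ∘L .fst ℂ X ℂ)

section

variable {X H Y P : Type*} [NormedAddCommGroup X] [NormedSpace ℂ X]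
  [NormedAddCommGroup H] [InnerProductSpace ℂ H]
  [NormedAddCommGroup Y] [NormedSpace ℂ Y] [NormedAddCommGroup P] [NormedSpace ℂ P]

theorem borderedOp_apply (J A : X →L[ℂ] H) (B : X →L[ℂ] Y) (j : H) (l : ℂ) (z : X × ℂ) :
    borderedOp J A B j l z = (A z.1 - l • J z.1 - z.2 • j, B z.1, inner ℂ j (J z.1)) := by
  simp [borderedOp]

theorem contDiff_borderedOp (J A : X →L[ℂ] H) (B : X →L[ℂ] Y) (β : P →L[ℂ] X →L[ℂ] Y) (j : H) :
    ContDiff ℂ 1 fun w : P × ℂ => borderedOp J A (B + β w.1) j w.2 := by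
  unfold borderedOp
  fun_prop

/-- An eigenvalue problem `A x = l J x` with boundary condition `(B + β p) x = 0`: if the bordered
operator is bijective at an eigenpair `(l₀, x₀)` for `p = 0` and Green's formula holds, then the
eigenpair continues uniquely and differentiably to small `p`. -/
theorem exists_eigenpair_continuation [CompleteSpace X] [CompleteSpace H] [CompleteSpace Y] [CompleteSpace P]
    (J A : X →L[ℂ] H) (B : X →L[ℂ] Y)
    (β : P →L[ℂ] X →L[ℂ] Y) (κ : P →L[ℂ] X →L[ℂ] ℂ) (l₀ : ℂ) (x₀ : X)
    (hA : A x₀ = l₀ • J x₀) (hB : B x₀ = 0) (hn : ‖J x₀‖ = 1)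
    (green : ∀ p x, (B + β p) x = 0 → inner ℂ (J x₀) (A x - l₀ • J x) = κ p x)
    (hbij : Function.Bijective (borderedOp J A B (J x₀) l₀)) :
    ∃ (U : Set P) (l : P → ℂ) (ξ : P → X), IsOpen U ∧ 0 ∈ U ∧ l 0 = l₀ ∧ ξ 0 = x₀ ∧
      DifferentiableOn ℂ l U ∧ DifferentiableOn ℂ ξ U ∧
      (∀ p ∈ U, A (ξ p) = l p • J (ξ p) ∧ (B + β p) (ξ p) = 0 ∧
        inner ℂ (J x₀) (J (ξ p)) = 1) ∧
      (∃ ε > 0, (∀ p ∈ U, ‖l p - l₀‖ < ε) ∧ ∀ p ∈ U, ∀ ν : ℂ, ‖ν - l₀‖ < ε → ∀ x, x ≠ 0 →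
        A x = ν • J x → (B + β p) x = 0 → ν = l p ∧ ∃ c : ℂ, x = c • ξ p) ∧
      HasFDerivAt l (κ.flip x₀) 0 := by
  set M : P × ℂ → (X × ℂ →L[ℂ] H × Y × ℂ) :=
    fun w => borderedOp J A (B + β w.1) (J x₀) w.2 with hM
  have hMc : ContDiff ℂ 1 M := contDiff_borderedOp J A B β (J x₀)
  have hn' : inner ℂ (J x₀) (J x₀) = 1 := by
    rw [inner_self_eq_norm_sq_to_K, hn]; simp
  let u : P × ℂ := (0, l₀)
  have hMu : M u = borderedOp J A B (J x₀) l₀ := by simp [hM, u]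
  have hinv : (M u).IsInvertible := by
    rw [hMu]
    exact ⟨ContinuousLinearEquiv.ofBijective _ (LinearMap.ker_eq_bot.2 hbij.1)
      (LinearMap.range_eq_top.2 hbij.2), rfl⟩
  have hev : ∀ᶠ w in nhds u, (M w).IsInvertible := by
    obtain ⟨e, he⟩ := hinv
    have h1 := hMc.continuous.tendsto u
    rw [← he] at h1
    exact h1.eventually (ContinuousLinearEquiv.nhds e)
  -- With `w = (p, l)` and `z w = (x, t)`: `x` satisfies the boundary condition, is normalized by
  -- `⟨J x₀, J x⟩ = 1`, and solves the eigenvalue equation up to the defect `t • J x₀`. Thus `t = 0`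
  -- is the scalar equation for the eigenvalue.
  set z : P × ℂ → X × ℂ := fun w => (M w).inverse (0, 0, 1) with hz
  have hzc : ContDiffAt ℂ 1 z u :=
    (hinv.contDiffAt_map_inverse.comp u hMc.contDiffAt).clm_apply contDiffAt_const
  have hz0 : z u = (x₀, 0) := by
    rw [hz]
    simp only
    rw [hinv.inverse_apply_eq, hMu, borderedOp_apply]
    simp [hA, hB, hn]
  have hzeq : ∀ w, (M w).IsInvertible → A (z w).1 - w.2 • J (z w).1 = (z w).2 • J x₀ ∧
      (B + β w.1) (z w).1 = 0 ∧ inner ℂ (J x₀) (J (z w).1) = 1 := by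
    intro w hw
    have h := hw.self_apply_inverse ((0, 0, 1) : H × Y × ℂ)
    change M w (z w) = _ at h
    simp only [hM, borderedOp_apply, Prod.mk.injEq] at h
    exact ⟨sub_eq_zero.1 h.1, h.2.1, h.2.2⟩
  -- The defect `t` in closed form, obtained by pairing the first equation with `J x₀` and applying
  -- Green's formula. This form makes the derivative at the base point explicit.
  let F : P × ℂ → ℂ := fun w => l₀ - w.2 + κ w.1 (z w).1
  have hF : ∀ w, (M w).IsInvertible → (z w).2 = F w := by
    intro w hw
    obtain ⟨h1, h2, h3⟩ := hzeq w hw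
    have h4 := green w.1 _ h2
    have h5 : A (z w).1 - l₀ • J (z w).1 = (z w).2 • J x₀ + (w.2 - l₀) • J (z w).1 := by
      rw [← h1, sub_smul]; abel
    rw [h5, inner_add_right, inner_smul_right, inner_smul_right, h3, hn'] at h4
    simp only [F, ← h4]
    ring
  have hFc : ContDiffAt ℂ 1 F u := by
    have h1 : ContDiffAt ℂ 1 (fun w => κ w.1) u := by fun_prop
    have h2 := h1.clm_apply hzc.fst
    exact (contDiffAt_const.sub contDiffAt_snd).add h2
  have hFu : F u = 0 := by simp [F, u]
  -- The unknown derivative of `z` does not contribute, since it is multiplied by `κ 0 = 0`.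
  have hFd : HasFDerivAt F ((κ.flip x₀) ∘L .fst ℂ P ℂ - .snd ℂ P ℂ) u := by
    have h1 : HasFDerivAt (fun w : P × ℂ => κ w.1) (κ ∘L .fst ℂ P ℂ) u :=
      (κ ∘L .fst ℂ P ℂ).hasFDerivAt
    have h2 : HasFDerivAt (fun w => (z w).1) (fderiv ℂ (fun w => (z w).1) u) u :=
      (hzc.fst.differentiableAt (by simp)).hasFDerivAt
    have h3 := ((hasFDerivAt_const l₀ u).sub (ContinuousLinearMap.snd ℂ P ℂ).hasFDerivAt).add
      (h1.clm_apply h2)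
    refine h3.congr_fderiv ?_
    ext v <;> simp [u, hz0]
  have hfd : fderiv ℂ F u = (κ.flip x₀) ∘L .fst ℂ P ℂ - .snd ℂ P ℂ := hFd.fderiv
  have hr : fderiv ℂ F u ∘L .inr ℂ P ℂ = -ContinuousLinearMap.id ℂ ℂ := by
    rw [hfd]; ext; simp
  have hri : (fderiv ℂ F u ∘L .inr ℂ P ℂ).IsInvertible := by
    rw [hr]
    exact ⟨ContinuousLinearEquiv.neg ℂ, by ext; simp⟩
  set ψ := hFc.implicitFunction one_ne_zero hri with hψ
  have hψ0 : ψ 0 = l₀ := hFc.implicitFunction_apply_self one_ne_zero hri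
  have hψc : ContDiffAt ℂ 1 ψ 0 := hFc.contDiffAt_implicitFunction one_ne_zero hri
  -- The uniqueness half of the implicit function theorem; it later shows that no other eigenvalue
  -- lies near `l₀`.
  have hψiff : ∀ᶠ v in nhds u, F v = 0 ↔ ψ v.1 = v.2 := by
    have := hFc.eventually_apply_eq_iff_implicitFunction one_ne_zero hri
    rwa [hFu] at this
  have hψd : HasFDerivAt ψ (κ.flip x₀) 0 := by
    have := (hFc.hasStrictFDerivAt_implicitFunction one_ne_zero hri).hasFDerivAt
    refine this.congr_fderiv ?_
    rw [hr, hfd]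
    have hi : (-ContinuousLinearMap.id ℂ ℂ).inverse = -ContinuousLinearMap.id ℂ ℂ := by
      have : -ContinuousLinearMap.id ℂ ℂ = (ContinuousLinearEquiv.neg ℂ : ℂ ≃L[ℂ] ℂ) := by
        ext; simp
      rw [this, ContinuousLinearMap.inverse_equiv]
      ext; simp
    rw [hi]
    ext; simp
  have hzd : ∀ᶠ w in nhds u, DifferentiableAt ℂ z w :=
    (hzc.eventually (by simp)).mono fun w hw => hw.differentiableAt (by simp)
  have hψdiff : ∀ᶠ p in nhds (0 : P), DifferentiableAt ℂ ψ p :=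
    (hψc.eventually (by simp)).mono fun w hw => hw.differentiableAt (by simp)
  -- Splitting into a product neighbourhood yields a radius `ε` for the spectral variable that does
  -- not depend on the parameter.
  obtain ⟨pa, hpa, pb, hpb, hab⟩ := Filter.eventually_prod_iff.1
    ((hev.and (hψiff.and hzd)).filter_mono (nhds_prod_eq (x := (0 : P)) (y := l₀)).ge)
  obtain ⟨ε, hε, hεb⟩ := Metric.eventually_nhds_iff.1 hpb
  have hψcont : ∀ᶠ p in nhds (0 : P), dist (ψ p) l₀ < ε := by
    have := hψc.continuousAt.tendsto
    rw [hψ0] at this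
    exact this.eventually (Metric.ball_mem_nhds _ hε)
  obtain ⟨U, hU, hUo, h0U⟩ := eventually_nhds_iff.1 (hpa.and (hψdiff.and hψcont))
  have hW : ∀ p ∈ U, (M (p, ψ p)).IsInvertible ∧ (F (p, ψ p) = 0 ↔ ψ p = ψ p) ∧
      DifferentiableAt ℂ z (p, ψ p) := fun p hp => hab (hU p hp).1 (hεb (hU p hp).2.2)
  refine ⟨U, ψ, fun p => (z (p, ψ p)).1, hUo, h0U, hψ0, ?_, ?_, ?_, ?_, ⟨ε, hε, ?_, ?_⟩, hψd⟩
  · change (z (0, ψ 0)).1 = x₀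
    rw [hψ0, hz0]
  · exact fun p hp => (hU p hp).2.1.differentiableWithinAt
  · intro p hp
    have h1 : DifferentiableAt ℂ (fun p => (p, ψ p)) p := differentiableAt_id.prodMk (hU p hp).2.1
    exact ((hW p hp).2.2.comp p h1).fst.differentiableWithinAt
  · intro p hp
    obtain ⟨h1, h2, -⟩ := hW p hp
    obtain ⟨h3, h4, h5⟩ := hzeq _ h1
    refine ⟨?_, h4, h5⟩
    rwa [hF _ h1, h2.2 rfl, zero_smul, sub_eq_zero] at h3
  · intro p hp
    rw [← dist_eq_norm]
    exact (hU p hp).2.2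
  · intro p hp ν hν x hx hAx hBx
    obtain ⟨h1, h2, -⟩ := hab (hU p hp).1 (hεb (by rwa [dist_eq_norm]) : pb ν)
    -- For any eigenvector `x`, the pair `(x, 0)` has image `(0, 0, ⟨J x₀, J x⟩)`, so it is a
    -- multiple of `z (p, ν)`. The multiple is nonzero because `x` is, and then the second component
    -- of `z (p, ν)` must vanish.
    have h3 : M (p, ν) (x, 0) = M (p, ν) (inner ℂ (J x₀) (J x) • z (p, ν)) := by
      rw [map_smul]
      have : M (p, ν) (z (p, ν)) = (0, 0, 1) := h1.self_apply_inverse _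
      rw [this]
      simp [hM, borderedOp_apply, hAx, hBx]
    have h4 : (x, (0 : ℂ)) = inner ℂ (J x₀) (J x) • z (p, ν) := by
      obtain ⟨e, he⟩ := h1
      rw [← he] at h3
      exact e.injective h3
    have h5 : x = inner ℂ (J x₀) (J x) • (z (p, ν)).1 := congrArg Prod.fst h4
    have h6 : 0 = inner ℂ (J x₀) (J x) * (z (p, ν)).2 := congrArg Prod.snd h4
    have hc : inner ℂ (J x₀) (J x) ≠ 0 := fun h0 => hx (by rw [h5, h0, zero_smul])
    have h7 : (z (p, ν)).2 = 0 := (mul_eq_zero.1 h6.symm).resolve_left hc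
    have h8 : ψ p = ν := h2.1 (by rw [← hF _ h1, h7])
    exact ⟨h8.symm, _, by
      change x = _ • (z (p, ψ p)).1
      rw [h8]
      exact h5⟩

/-- `exists_eigenpair_continuation` around an arbitrary base point. -/
theorem exists_eigenpair_continuation_at [CompleteSpace X] [CompleteSpace H] [CompleteSpace Y]
    [CompleteSpace P] (J A : X →L[ℂ] H) (B : X →L[ℂ] Y)
    (β : P →L[ℂ] X →L[ℂ] Y) (κ : P →L[ℂ] X →L[ℂ] ℂ) (l₀ : ℂ) (x₀ : X) (p₀ : P)
    (hA : A x₀ = l₀ • J x₀) (hB : B x₀ = 0) (hn : ‖J x₀‖ = 1)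
    (green : ∀ p x, (B + β p) x = 0 → inner ℂ (J x₀) (A x - l₀ • J x) = κ p x)
    (hbij : Function.Bijective (borderedOp J A B (J x₀) l₀)) :
    ∃ (U : Set P) (l : P → ℂ) (ξ : P → X), IsOpen U ∧ p₀ ∈ U ∧ l p₀ = l₀ ∧ ξ p₀ = x₀ ∧
      DifferentiableOn ℂ l U ∧ DifferentiableOn ℂ ξ U ∧
      (∀ p ∈ U, A (ξ p) = l p • J (ξ p) ∧ (B + β (p - p₀)) (ξ p) = 0 ∧ J (ξ p) ≠ 0) ∧
      (∃ ε > 0, (∀ p ∈ U, ‖l p - l₀‖ < ε) ∧ ∀ p ∈ U, ∀ ν : ℂ, ‖ν - l₀‖ < ε → ∀ x, x ≠ 0 →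
        A x = ν • J x → (B + β (p - p₀)) x = 0 → ν = l p ∧ ∃ c : ℂ, x = c • ξ p) ∧
      ∃ D : P →L[ℂ] ℂ, HasFDerivAt l D p₀ ∧ ∀ T, D T = κ T x₀ := by
  obtain ⟨U, l, ξ, hU, h0U, hl0, hξ0, hl, hξ, heig, ⟨ε, hε, hlε, huniq⟩, hD⟩ :=
    exists_eigenpair_continuation J A B β κ l₀ x₀ hA hB hn green hbij
  let σ : P → P := fun p => p - p₀
  have hσd : Differentiable ℂ σ := differentiable_id.sub_const _
  have hσ0 : σ p₀ = 0 := sub_self _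
  have hm : MapsTo σ (σ ⁻¹' U) U := mapsTo_preimage _ _
  refine ⟨σ ⁻¹' U, fun p => l (σ p), fun p => ξ (σ p), hU.preimage hσd.continuous, ?_, ?_, ?_,
    hl.comp hσd.differentiableOn hm, hξ.comp hσd.differentiableOn hm, ?_,
    ⟨ε, hε, fun p hp => hlε _ hp, fun p hp => huniq (σ p) hp⟩, κ.flip x₀, ?_, fun T => rfl⟩
  · rw [mem_preimage, hσ0]
    exact h0U
  · change l (σ p₀) = l₀
    rw [hσ0, hl0]
  · change ξ (σ p₀) = x₀
    rw [hσ0, hξ0]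
  · intro p hp
    obtain ⟨h1, h2, h3⟩ := heig (σ p) hp
    refine ⟨h1, h2, fun h => ?_⟩
    rw [h, inner_zero_right] at h3
    exact zero_ne_one h3
  · have h1 : HasFDerivAt σ (ContinuousLinearMap.id ℂ P) p₀ := (hasFDerivAt_id _).sub_const _
    rw [← hσ0] at hD
    have h2 : HasFDerivAt (fun p => l (σ p)) (κ.flip x₀ ∘L ContinuousLinearMap.id ℂ P) p₀ :=
      hD.comp p₀ h1
    rwa [ContinuousLinearMap.comp_id] at h2

end

/-! ### Multiplication by a bounded function -/

/-- Multiplication by a bounded real-valued function in `L²(0, ℓ)`. -/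
def edgeMul {ℓ : ℝ} (q : Lp ℝ ∞ (edgeMeasure ℓ)) : EdgeL2 ℓ →L[ℂ] EdgeL2 ℓ :=
  LinearMap.mkContinuous
    { toFun := fun u => (q • u : EdgeL2 ℓ)
      map_add' := fun u v => Lp.add_smul q u v
      map_smul' := by
        intro z u
        refine Lp.ext ?_
        filter_upwards [Lp.coeFn_lpSMul (r := 2) q (z • u), Lp.coeFn_smul z u,
          Lp.coeFn_smul z (q • u : EdgeL2 ℓ), Lp.coeFn_lpSMul (r := 2) q u] with x h1 h2 h3 h4
        rw [RingHom.id_apply, h1, h3, Pi.smul_apply', h2, Pi.smul_apply, Pi.smul_apply, h4,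
          Pi.smul_apply', smul_comm] } ‖q‖ fun u => Lp.norm_smul_le q u

theorem edgeMul_apply {ℓ : ℝ} (q : Lp ℝ ∞ (edgeMeasure ℓ)) (u : EdgeL2 ℓ) :
    edgeMul q u = (q • u : EdgeL2 ℓ) := rfl

theorem coeFn_edgeMul {ℓ : ℝ} (q : Lp ℝ ∞ (edgeMeasure ℓ)) (u : EdgeL2 ℓ) :
    edgeMul q u =ᵐ[edgeMeasure ℓ] fun x => q x • u x :=
  Lp.coeFn_lpSMul (r := 2) q u

theorem edgeMul_ae_bound {ℓ : ℝ} (q : Lp ℝ ∞ (edgeMeasure ℓ)) :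
    ∀ᵐ x ∂edgeMeasure ℓ, ‖q x‖ ≤ ‖q‖ := by
  filter_upwards [ae_le_eLpNormEssSup (f := q) (μ := edgeMeasure ℓ)] with x hx
  rw [Lp.norm_def, eLpNorm_exponent_top, ← toReal_enorm]
  refine ENNReal.toReal_mono ?_ hx
  rw [← eLpNorm_exponent_top]
  exact Lp.eLpNorm_ne_top q

/-- This holds because `q` is real-valued; it removes the potential from Green's formula. -/
theorem inner_edgeMul {ℓ : ℝ} (q : Lp ℝ ∞ (edgeMeasure ℓ)) (u w : EdgeL2 ℓ) :
    inner ℂ (edgeMul q u) w = inner ℂ u (edgeMul q w) := by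
  rw [L2.inner_def, L2.inner_def]
  refine integral_congr_ae ?_
  filter_upwards [coeFn_edgeMul q u, coeFn_edgeMul q w] with x h1 h2
  rw [h1, h2, RCLike.inner_apply, RCLike.inner_apply, Complex.real_smul, Complex.real_smul,
    map_mul, Complex.conj_ofReal]
  ring

/-- Green's formula for a function `a + ∫₀ˣ g` and a function with derivative `h`. -/
theorem inner_edgeConst_add_edgePrim {ℓ : ℝ} (hℓ : 0 ≤ ℓ) (a b : ℂ) (g h : EdgeL2 ℓ) :
    inner ℂ (edgeConst ℓ a + edgePrim ℓ g) h =
      starRingEnd ℂ (a + edgeInt ℓ g) * (b + edgeInt ℓ h) - starRingEnd ℂ a * b -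
        inner ℂ g (edgeConst ℓ b + edgePrim ℓ h) := by
  have hc : ∀ (c : ℂ) (u : EdgeL2 ℓ), inner ℂ (edgeConst ℓ c) u = starRingEnd ℂ c * edgeInt ℓ u := by
    intro c u
    rw [show c = c • (1 : ℂ) by simp, map_smul, inner_smul_left]
    simp [edgeInt]
  have hc' : inner ℂ g (edgeConst ℓ b) = starRingEnd ℂ (edgeInt ℓ g) * b := by
    rw [← inner_conj_symm, hc]
    simp [mul_comm]
  have h1 := inner_edgePrim_add_inner_edgePrim hℓ g h
  rw [inner_add_left, inner_add_right, hc, hc', eq_sub_of_add_eq h1, map_add]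
  ring

/-! ### Vertex conditions as kernels of operators -/

namespace VertexCondition

variable {ι : Type*} [Fintype ι] (c : VertexCondition ι)

/-- `robinPart` as a continuous linear map. -/
def robinL : EuclideanSpace ℂ ι →L[ℂ] c.PR.range := LinearMap.toContinuousLinearMap c.robinPart

theorem robinL_apply (F : EuclideanSpace ℂ ι) : c.robinL F = c.robinPart F := rfl

theorem coe_robinL (F : EuclideanSpace ℂ ι) : (c.robinL F : EuclideanSpace ℂ ι) = c.PR F := rfl

theorem inner_eq_zero_of_isOrtho {A B : EuclideanSpace ℂ ι →L[ℂ] EuclideanSpace ℂ ι}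
    (h : A.range ⟂ B.range) (F G : EuclideanSpace ℂ ι) : inner ℂ (A F) (B G) = 0 :=
  h.inner_eq (LinearMap.mem_range_self A.toLinearMap F) (LinearMap.mem_range_self B.toLinearMap G)

theorem decomp (F : EuclideanSpace ℂ ι) : F = c.PD F + c.PN F + c.PR F := by
  exact (congrArg (fun T : EuclideanSpace ℂ ι →L[ℂ] EuclideanSpace ℂ ι => T F) c.sum_eq_one).symm

/-- The three summands lie in mutually orthogonal ranges, so their sum vanishes only if each does. A
vertex condition thus becomes one equation in `ℂ^ι`, with exactly one scalar equation per edge end.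
-/
theorem holds_iff (F F' : EuclideanSpace ℂ ι) : c.Holds F F' ↔
    c.PD F + c.PN F' + (c.robinL F' - c.Λ (c.robinL F) : c.PR.range) = 0 := by
  constructor
  · rintro ⟨h1, h2, h3⟩
    rw [h1, h2, robinL_apply, robinL_apply, h3, sub_self]
    simp
  · intro h
    set r : c.PR.range := c.robinL F' - c.Λ (c.robinL F) with hr
    obtain ⟨y, hy⟩ : ∃ y, c.PR y = r := r.2
    rw [← hy] at h
    have o1 := inner_eq_zero_of_isOrtho c.ortho_DN
    have o2 := inner_eq_zero_of_isOrtho c.ortho_DR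
    have o3 := inner_eq_zero_of_isOrtho c.ortho_NR
    have o1' := inner_eq_zero_of_isOrtho c.ortho_DN.symm
    have o2' := inner_eq_zero_of_isOrtho c.ortho_DR.symm
    have o3' := inner_eq_zero_of_isOrtho c.ortho_NR.symm
    refine ⟨?_, ?_, ?_⟩
    · have := congrArg (inner ℂ (c.PD F)) h
      rwa [inner_add_right, inner_add_right, o1, o2, add_zero, add_zero, inner_zero_right,
        inner_self_eq_zero] at this
    · have := congrArg (inner ℂ (c.PN F')) h
      rwa [inner_add_right, inner_add_right, o1', o3, zero_add, add_zero, inner_zero_right,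
        inner_self_eq_zero] at this
    · have := congrArg (inner ℂ (c.PR y)) h
      rw [inner_add_right, inner_add_right, o2', o3', zero_add, zero_add, inner_zero_right,
        inner_self_eq_zero, hy] at this
      have h0 : r = 0 := Subtype.ext this
      exact sub_eq_zero.1 h0

/-- `F` has only Neumann and Robin parts and `G` only Dirichlet and Robin parts, so orthogonality
leaves the Robin parts alone. -/
theorem inner_eq_inner_robinL {F G : EuclideanSpace ℂ ι} (hF : c.PD F = 0) (hG : c.PN G = 0) :
    inner ℂ F G = inner ℂ (c.robinL F) (c.robinL G) := by
  rw [Submodule.coe_inner, coe_robinL, coe_robinL]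
  conv_lhs => rw [c.decomp F, c.decomp G]
  simp only [hF, hG, zero_add, add_zero, inner_add_left, inner_add_right,
    inner_eq_zero_of_isOrtho c.ortho_DN.symm, inner_eq_zero_of_isOrtho c.ortho_NR,
    inner_eq_zero_of_isOrtho c.ortho_DR.symm]

/-- The boundary form at a vertex for a pair satisfying the condition and a pair satisfying a
perturbed one. -/
theorem boundary_form {T : c.PR.range →L[ℂ] c.PR.range} {F F' D D' : EuclideanSpace ℂ ι}
    (hs : LinearMap.IsSymmetric (𝕜 := ℂ) (E := c.PR.range) c.Λ) (hF : c.Holds F F')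
    (hD : (c.withRobin (c.Λ + T)).Holds D D') :
    inner ℂ F D' - inner ℂ F' D = inner ℂ (c.robinL F) (T (c.robinL D)) := by
  obtain ⟨h1, h2, h3⟩ := hF
  obtain ⟨k1, k2, k3⟩ := hD
  have k3' : c.robinL D' = c.Λ (c.robinL D) + T (c.robinL D) := k3
  have h3' : c.robinL F' = c.Λ (c.robinL F) := h3
  -- Here the derivative vector stands in the first slot, so `inner_eq_inner_robinL` is applied to
  -- the conjugate.
  have e : inner ℂ F' D = inner ℂ (c.robinL F') (c.robinL D) := by
    rw [← inner_conj_symm, c.inner_eq_inner_robinL k1 h2]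
    exact inner_conj_symm (𝕜 := ℂ) (E := c.PR.range) _ _
  have e' : inner ℂ (c.Λ (c.robinL F)) (c.robinL D) = inner ℂ (c.robinL F) (c.Λ (c.robinL D)) :=
    hs (c.robinL F) (c.robinL D)
  have e'' : inner ℂ (c.robinL F) (c.Λ (c.robinL D) + T (c.robinL D)) =
      inner ℂ (c.robinL F) (c.Λ (c.robinL D)) + inner ℂ (c.robinL F) (T (c.robinL D)) :=
    inner_add_right (𝕜 := ℂ) (E := c.PR.range) _ _ _
  rw [c.inner_eq_inner_robinL h1 k2, e, k3', h3', e', e'']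
  exact add_sub_cancel_left _ _

end VertexCondition

/-! ### Parametrization of the functions in `H²` on each edge -/

namespace MetricGraph

variable {V E : Type*} [Fintype E] (G : MetricGraph V E)

/-- The data of a function in `H²` on each edge: its second derivative, and its value and first
derivative at the origin of each edge. -/
abbrev H2Data {V E : Type*} [Fintype E] (G : MetricGraph V E) := G.L2 × (E → ℂ) × (E → ℂ)

/-- The operator into `L²(Γ)` with given components. -/
def edgewise {X : Type*} [NormedAddCommGroup X] [NormedSpace ℂ X]
    (T : ∀ e, X →L[ℂ] EdgeL2 (G.L e)) : X →L[ℂ] G.L2 :=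
  ((PiLp.continuousLinearEquiv 2 ℂ fun e => EdgeL2 (G.L e)).symm : _ →L[ℂ] G.L2) ∘L
    ContinuousLinearMap.pi T

/-- The derivative of the function with given data. -/
def dataGrad : G.H2Data →L[ℂ] G.L2 :=
  G.edgewise fun e =>
    edgeConst (G.L e) ∘L .proj e ∘L .snd ℂ (E → ℂ) (E → ℂ) ∘L .snd ℂ G.L2 _ +
      edgePrim (G.L e) ∘L PiLp.proj 2 (fun e => EdgeL2 (G.L e)) e ∘L .fst ℂ G.L2 _

/-- The function with given data. -/
def dataFun : G.H2Data →L[ℂ] G.L2 :=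
  G.edgewise fun e =>
    edgeConst (G.L e) ∘L .proj e ∘L .fst ℂ (E → ℂ) (E → ℂ) ∘L .snd ℂ G.L2 _ +
      edgePrim (G.L e) ∘L PiLp.proj 2 (fun e => EdgeL2 (G.L e)) e ∘L G.dataGrad

/-- The Schrödinger expression on the function with given data. -/
def dataHam (q : G.Potential) : G.H2Data →L[ℂ] G.L2 :=
  G.edgewise fun e =>
    edgeMul (q e) ∘L PiLp.proj 2 (fun e => EdgeL2 (G.L e)) e ∘L G.dataFun -
      PiLp.proj 2 (fun e => EdgeL2 (G.L e)) e ∘L .fst ℂ G.L2 _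

theorem dataGrad_apply (x : G.H2Data) (e : E) :
    G.dataGrad x e = edgeConst (G.L e) (x.2.2 e) + edgePrim (G.L e) (x.1 e) := rfl

theorem dataFun_apply (x : G.H2Data) (e : E) :
    G.dataFun x e = edgeConst (G.L e) (x.2.1 e) + edgePrim (G.L e) (G.dataGrad x e) := rfl

theorem dataHam_apply (q : G.Potential) (x : G.H2Data) (e : E) :
    G.dataHam q x e = edgeMul (q e) (G.dataFun x e) - x.1 e := rfl

/-- The value at an edge end. -/
def endValue (p : E × Bool) : G.H2Data →L[ℂ] ℂ :=
  .proj p.1 ∘L .fst ℂ (E → ℂ) (E → ℂ) ∘L .snd ℂ G.L2 _ +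
    if p.2 then edgeInt (G.L p.1) ∘L PiLp.proj 2 (fun e => EdgeL2 (G.L e)) p.1 ∘L G.dataGrad else 0

/-- The derivative at an edge end, pointing into the edge. -/
def endDeriv (p : E × Bool) : G.H2Data →L[ℂ] ℂ :=
  (if p.2 then -1 else 1 : ℂ) • (.proj p.1 ∘L .snd ℂ (E → ℂ) (E → ℂ) ∘L .snd ℂ G.L2 _ +
    if p.2 then edgeInt (G.L p.1) ∘L PiLp.proj 2 (fun e => EdgeL2 (G.L e)) p.1 ∘L .fst ℂ G.L2 _
      else 0)

theorem isWeakDeriv_dataFun (x : G.H2Data) (e : E) :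
    IsWeakDeriv (G.dataFun x e) (G.dataGrad x e) :=
  isWeakDeriv_edgeConst_add_edgePrim (G.L_pos e) _ _

theorem isWeakDeriv_dataGrad (x : G.H2Data) (e : E) : IsWeakDeriv (G.dataGrad x e) (x.1 e) :=
  isWeakDeriv_edgeConst_add_edgePrim (G.L_pos e) _ _

theorem memH2_dataFun (x : G.H2Data) (e : E) : MemH2 (G.dataFun x e) :=
  ⟨_, G.isWeakDeriv_dataFun x e, _, G.isWeakDeriv_dataGrad x e⟩

theorem grad_dataFun (x : G.H2Data) : G.grad (G.dataFun x) = G.dataGrad x := by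
  ext1 e
  exact (G.isWeakDeriv_dataFun x e).weakDeriv_eq

theorem exists_dataFun_eq {f : G.L2} (hf : ∀ e, MemH2 (f e)) : ∃ x, G.dataFun x = f := by
  choose g hg hg' using hf
  choose h hh using hg'
  choose b hb using fun e => (hh e).exists_eq_edgeConst_add_edgePrim (G.L_pos e)
  choose a ha using fun e => (hg e).exists_eq_edgeConst_add_edgePrim (G.L_pos e)
  refine ⟨(WithLp.toLp 2 h, a, b), ?_⟩
  ext1 e
  rw [dataFun_apply, dataGrad_apply]
  simp only
  rw [← hb, ← ha]

theorem contRep_end {ℓ : ℝ} (hℓ : 0 < ℓ) (c : ℂ) (g : EdgeL2 ℓ) (b : Bool) :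
    contRep (edgeConst ℓ c + edgePrim ℓ g) (if b then ℓ else 0) =
      c + if b then edgeInt ℓ g else 0 := by
  rw [contRep_edgeConst_add_edgePrim hℓ c g (by cases b <;> simp [hℓ.le])]
  cases b <;> simp [edgeInt_apply hℓ.le]

theorem contRep_dataFun_end (x : G.H2Data) (p : E × Bool) :
    contRep (G.dataFun x p.1) (G.endCoord p) = G.endValue p x := by
  rw [dataFun_apply, endCoord, contRep_end (G.L_pos _)]
  obtain ⟨e, b⟩ := p
  cases b <;> simp [endValue]

theorem contRep_dataGrad_end (x : G.H2Data) (p : E × Bool) :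
    (if p.2 then -1 else 1 : ℂ) * contRep (weakDeriv (G.dataFun x p.1)) (G.endCoord p) =
      G.endDeriv p x := by
  rw [(G.isWeakDeriv_dataFun x p.1).weakDeriv_eq, dataGrad_apply, endCoord,
    contRep_end (G.L_pos _)]
  obtain ⟨e, b⟩ := p
  cases b
  · simp [endDeriv]
  · simp only [endDeriv, ↓reduceIte, smul_apply, smul_eq_mul]
    rfl

/-- Uniqueness of weak derivatives recovers first the gradient and then the second derivative; what
remains is constant on each edge. -/
theorem dataFun_injective : Function.Injective G.dataFun := by
  refine (injective_iff_map_eq_zero G.dataFun).2 fun x hx => ?_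
  have hz : ∀ e, G.dataGrad x e = 0 := by
    intro e
    refine (G.isWeakDeriv_dataFun x e).unique ?_
    rw [hx]
    exact IsWeakDeriv.zero
  have h1 : ∀ e, x.1 e = 0 := by
    intro e
    refine (G.isWeakDeriv_dataGrad x e).unique ?_
    rw [hz]
    exact IsWeakDeriv.zero
  -- The value at `0` of the continuous representative of the zero class is computed in two ways, as
  -- `c` and as `0`.
  have hc : ∀ (e : E) (c : ℂ), edgeConst (G.L e) c = 0 → c = 0 := by
    intro e c h0
    have hL := G.L_pos e
    have h2 := contRep_end hL c 0 false
    have h3 := contRep_end hL 0 0 false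
    rw [h0] at h2
    rw [map_zero, map_zero, zero_add] at h3
    rw [map_zero, zero_add, h3] at h2
    simpa using h2.symm
  refine Prod.ext ?_ (Prod.ext (funext fun e => hc e _ ?_) (funext fun e => hc e _ ?_))
  · ext1 e
    exact h1 e
  · have := G.dataFun_apply x e
    rw [hz, hx, map_zero, add_zero] at this
    exact this.symm
  · have := G.dataGrad_apply x e
    rw [hz, h1, map_zero, add_zero] at this
    exact this.symm

/-- Integration by parts on both sides produces the same inner product of gradients, which cancels
together with the potential. The sign built into `endDeriv` at terminal ends turns the difference of
endpoint terms into a sum over ends. -/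
theorem inner_dataFun_dataHam_edge (q : G.Potential) (x y : G.H2Data) (e : E) :
    inner ℂ (G.dataFun x e) (G.dataHam q y e) - inner ℂ (G.dataHam q x e) (G.dataFun y e) =
      ∑ b : Bool, (starRingEnd ℂ (G.endValue (e, b) x) * G.endDeriv (e, b) y -
        starRingEnd ℂ (G.endDeriv (e, b) x) * G.endValue (e, b) y) := by
  have hL := (G.L_pos e).le
  have h1 : inner ℂ (G.dataFun x e) (y.1 e) = _ :=
    inner_edgeConst_add_edgePrim hL (x.2.1 e) (y.2.2 e) (G.dataGrad x e) (y.1 e)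
  have h2 : inner ℂ (G.dataFun y e) (x.1 e) = _ :=
    inner_edgeConst_add_edgePrim hL (y.2.1 e) (x.2.2 e) (G.dataGrad y e) (x.1 e)
  rw [← dataGrad_apply] at h1 h2
  have h3 := congrArg (starRingEnd ℂ) h2
  simp only [map_sub, map_mul, inner_conj_symm, RingHomCompTriple.comp_apply, RingHom.id_apply]
    at h3
  rw [dataHam_apply, dataHam_apply, inner_sub_right, inner_sub_left, inner_edgeMul, h1, h3]
  simp [endValue, endDeriv]
  ring

/-- The vector of boundary values at a vertex. -/
def dataValue (v : V) : G.H2Data →L[ℂ] EuclideanSpace ℂ (G.Ends v) :=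
  ((EuclideanSpace.equiv (G.Ends v) ℂ).symm : _ →L[ℂ] EuclideanSpace ℂ (G.Ends v)) ∘L
    ContinuousLinearMap.pi fun p : G.Ends v => G.endValue p.1

/-- The vector of boundary derivatives at a vertex. -/
def dataDeriv (v : V) : G.H2Data →L[ℂ] EuclideanSpace ℂ (G.Ends v) :=
  ((EuclideanSpace.equiv (G.Ends v) ℂ).symm : _ →L[ℂ] EuclideanSpace ℂ (G.Ends v)) ∘L
    ContinuousLinearMap.pi fun p : G.Ends v => G.endDeriv p.1

theorem bdryValue_dataFun (x : G.H2Data) (v : V) :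
    G.bdryValue (G.dataFun x) v = G.dataValue v x := by
  ext p
  exact G.contRep_dataFun_end x p.1

theorem bdryDeriv_dataFun (x : G.H2Data) (v : V) :
    G.bdryDeriv (G.dataFun x) v = G.dataDeriv v x := by
  ext p
  exact G.contRep_dataGrad_end x p.1

section

variable [DecidableEq V]

/-- The sets of edge ends at the vertices are the fibres of the map sending an end to its vertex, so
they partition all ends; a loop enters with both of its ends. -/
theorem sum_ends [Fintype V] {M : Type*} [AddCommMonoid M] (φ : E × Bool → M) :
    ∑ v, ∑ p : G.Ends v, φ p.1 = ∑ e, ∑ b, φ (e, b) := by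
  rw [← Fintype.sum_prod_type, ← (Equiv.sigmaFiberEquiv
    fun p : E × Bool => if p.2 then G.t p.1 else G.o p.1).sum_comp, Fintype.sum_sigma]
  rfl

/-- Green's formula on the graph. -/
theorem inner_dataFun_dataHam [Fintype V] (q : G.Potential) (x y : G.H2Data) :
    inner ℂ (G.dataFun x) (G.dataHam q y) - inner ℂ (G.dataHam q x) (G.dataFun y) =
      ∑ v, (inner ℂ (G.dataValue v x) (G.dataDeriv v y) -
        inner ℂ (G.dataDeriv v x) (G.dataValue v y)) := by
  rw [PiLp.inner_apply, PiLp.inner_apply, ← Finset.sum_sub_distrib]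
  simp only [inner_dataFun_dataHam_edge]
  rw [← G.sum_ends fun p => starRingEnd ℂ (G.endValue p x) * G.endDeriv p y -
        starRingEnd ℂ (G.endDeriv p x) * G.endValue p y]
  refine Finset.sum_congr rfl fun v _ => ?_
  rw [PiLp.inner_apply, PiLp.inner_apply, ← Finset.sum_sub_distrib]
  refine Finset.sum_congr rfl fun p _ => ?_
  rw [RCLike.inner_apply, RCLike.inner_apply, mul_comm, mul_comm (G.dataValue v y p)]
  rfl

/-- `dataFun` parametrizes exactly the functions in `H²` on each edge, so the eigenvalue problem of
the unbounded operator becomes a system for bounded operators on a space independent of the vertex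
conditions. -/
theorem mem_eigenspaceOf_hamiltonian (q : G.Potential) (C : ∀ v, VertexCondition (G.Ends v))
    (ν : ℂ) (f : G.L2) : f ∈ eigenspaceOf (G.hamiltonian q C) ν ↔
      ∃ x, G.dataFun x = f ∧ G.dataHam q x = ν • G.dataFun x ∧
        ∀ v, (C v).Holds (G.dataValue v x) (G.dataDeriv v x) := by
  have key : ∀ (x : G.H2Data) (h : G.dataFun x ∈ G.hamiltonianDomain C),
      (G.hamiltonian q C).toFun ⟨G.dataFun x, h⟩ = G.dataHam q x := by
    intro x h
    ext1 e
    change -weakDeriv (weakDeriv (G.dataFun x e)) + (q e • G.dataFun x e : EdgeL2 (G.L e)) = _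
    rw [(G.isWeakDeriv_dataFun x e).weakDeriv_eq, (G.isWeakDeriv_dataGrad x e).weakDeriv_eq,
      dataHam_apply, edgeMul_apply]
    abel
  constructor
  · rintro ⟨⟨f, hf⟩, h1, rfl⟩
    obtain ⟨x, rfl⟩ := G.exists_dataFun_eq hf.1
    refine ⟨x, rfl, ?_, fun v => ?_⟩
    · rw [← key x hf]
      exact sub_eq_zero.1 (LinearMap.mem_ker.1 h1)
    · have := hf.2 v
      rwa [bdryValue_dataFun, bdryDeriv_dataFun] at this
  · rintro ⟨x, rfl, h1, h2⟩
    have hx : G.dataFun x ∈ G.hamiltonianDomain C :=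
      ⟨G.memH2_dataFun x, fun v => by rw [bdryValue_dataFun, bdryDeriv_dataFun]; exact h2 v⟩
    refine ⟨⟨G.dataFun x, hx⟩, LinearMap.mem_ker.2 ?_, rfl⟩
    refine sub_eq_zero.2 ?_
    rw [key x hx]
    exact h1

end

end MetricGraph

/-- The map `T ↦ S ∘ T ∘ g`, as a continuous linear map. -/
def sandwichL {X R R' Y : Type*} [NormedAddCommGroup X] [NormedSpace ℂ X]
    [NormedAddCommGroup R] [NormedSpace ℂ R] [NormedAddCommGroup R'] [NormedSpace ℂ R']
    [NormedAddCommGroup Y] [NormedSpace ℂ Y]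
    (S : R' →L[ℂ] Y) (g : X →L[ℂ] R) : (R →L[ℂ] R') →L[ℂ] X →L[ℂ] Y :=
  (ContinuousLinearMap.compL ℂ X R' Y S) ∘L (ContinuousLinearMap.compL ℂ X R R').flip g

/-! ### The boundary map of a vertex condition and its dependence on the Robin operator -/

namespace VertexCondition

variable {ι : Type*} [Fintype ι] {X : Type*} [NormedAddCommGroup X] [NormedSpace ℂ X]

/-- The operator whose kernel is described by a vertex condition. -/
def condOp (c : VertexCondition ι) (S S' : X →L[ℂ] EuclideanSpace ℂ ι) :
    X →L[ℂ] EuclideanSpace ℂ ι :=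
  c.PD ∘L S + c.PN ∘L S' +
    c.PR.range.subtypeL ∘L (c.robinL ∘L S' - c.Λ ∘L c.robinL ∘L S)

theorem condOp_eq_zero_iff (c : VertexCondition ι) (S S' : X →L[ℂ] EuclideanSpace ℂ ι) (x : X) :
    c.condOp S S' x = 0 ↔ c.Holds (S x) (S' x) :=
  (c.holds_iff (S x) (S' x)).symm

/-- The boundary map is affine in the Robin operator, so varying `Λ` is a bounded linear
perturbation. -/
theorem condOp_withRobin (c : VertexCondition ι) (T : c.PR.range →L[ℂ] c.PR.range)
    (S S' : X →L[ℂ] EuclideanSpace ℂ ι) (x : X) :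
    (c.withRobin (c.Λ + T)).condOp S S' x =
      c.condOp S S' x - (T (c.robinL (S x)) : c.PR.range) := by
  change c.PD (S x) + c.PN (S' x) +
      ((c.robinL (S' x) - (c.Λ (c.robinL (S x)) + T (c.robinL (S x))) : c.PR.range) : _) =
    c.PD (S x) + c.PN (S' x) +
      ((c.robinL (S' x) - c.Λ (c.robinL (S x)) : c.PR.range) : _) - _
  push_cast
  abel

end VertexCondition

/-! ### Boundary value problem on the graph and bijectivity of the bordered operator -/

namespace MetricGraph

variable {V E : Type*} [Fintype E] (G : MetricGraph V E)

/-- For vanishing initial data the equation `-h + (q - l) f = g`, `f'' = h`, has exactly one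
solution. -/
theorem bijective_dataHam_sub (q : G.Potential) (l : ℂ) :
    Function.Bijective fun h : G.L2 => G.dataHam q (h, 0, 0) - l • G.dataFun (h, 0, 0) := by
  -- With zero initial data `f` is the double primitive of `h`, so up to sign the map is, on each
  -- edge, the identity minus a Volterra operator.
  have hu : ∀ e, Function.Bijective fun h : EdgeL2 (G.L e) =>
      (1 - (edgeMul (q e) - l • 1) * (edgePrim (G.L e) * edgePrim (G.L e))) h := by
    intro e
    refine ContinuousLinearMap.isUnit_iff_bijective.1
      (isUnit_one_sub_edgePrim_sq (edgeMul (q e) - l • 1) (M := ‖q e‖ + ‖l‖) ?_ (by positivity))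
    intro u
    have e1 : (edgeMul (q e) - l • 1 : EdgeL2 (G.L e) →L[ℂ] EdgeL2 (G.L e)) u =
        edgeMul (q e) u - l • u := rfl
    rw [e1]
    filter_upwards [Lp.coeFn_sub (edgeMul (q e) u) (l • u), Lp.coeFn_smul l u,
      coeFn_edgeMul (q e) u, edgeMul_ae_bound (q e)] with x h1 h2 h3 h4
    rw [h1, Pi.sub_apply, h2, Pi.smul_apply, h3]
    refine (norm_sub_le _ _).trans ?_
    rw [norm_smul, norm_smul, add_mul]
    gcongr
  have hT : ∀ (h : G.L2) (e : E), (G.dataHam q (h, 0, 0) - l • G.dataFun (h, 0, 0)) e =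
      -(1 - (edgeMul (q e) - l • 1) * (edgePrim (G.L e) * edgePrim (G.L e))) (h e) := by
    intro h e
    rw [PiLp.sub_apply, PiLp.smul_apply, dataHam_apply, dataFun_apply, dataGrad_apply]
    simp only [Pi.zero_apply, map_zero, zero_add]
    change edgeMul (q e) (edgePrim (G.L e) (edgePrim (G.L e) (h e))) - h e -
      l • edgePrim (G.L e) (edgePrim (G.L e) (h e)) = -(h e -
        (edgeMul (q e) (edgePrim (G.L e) (edgePrim (G.L e) (h e))) -
      l • edgePrim (G.L e) (edgePrim (G.L e) (h e))))
    abel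
  constructor
  · intro h h' hh
    ext1 e
    refine (hu e).1 (neg_injective ?_)
    rw [← hT, ← hT]
    exact congrArg (fun w : G.L2 => w e) hh
  · intro g
    choose h hh using fun e => (hu e).2 (-g e)
    refine ⟨WithLp.toLp 2 h, ?_⟩
    ext1 e
    refine (hT _ e).trans ?_
    exact (congrArg Neg.neg (hh e)).trans (neg_neg _)

variable [DecidableEq V]

/-- The operator whose kernel is described by all vertex conditions. -/
def dataCond (C : ∀ v, VertexCondition (G.Ends v)) :
    G.H2Data →L[ℂ] ∀ v, EuclideanSpace ℂ (G.Ends v) :=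
  ContinuousLinearMap.pi fun v => (C v).condOp (G.dataValue v) (G.dataDeriv v)

theorem dataCond_eq_zero_iff (C : ∀ v, VertexCondition (G.Ends v)) (x : G.H2Data) :
    G.dataCond C x = 0 ↔ ∀ v, (C v).Holds (G.dataValue v x) (G.dataDeriv v x) := by
  rw [funext_iff]
  exact forall_congr' fun v => (C v).condOp_eq_zero_iff _ _ x

/-- The change of `dataCond` caused by a change of the Robin operator at one vertex. -/
def robinPerturbation [Fintype V] (v₀ : V) (c : VertexCondition (G.Ends v₀)) :
    (c.PR.range →L[ℂ] c.PR.range) →L[ℂ]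
      G.H2Data →L[ℂ] ∀ v, EuclideanSpace ℂ (G.Ends v) :=
  sandwichL (-(ContinuousLinearMap.single ℂ (fun v => EuclideanSpace ℂ (G.Ends v)) v₀ ∘L
    c.PR.range.subtypeL)) (c.robinL ∘L G.dataValue v₀)

theorem robinPerturbation_apply [Fintype V] (v₀ : V) (c : VertexCondition (G.Ends v₀))
    (T : c.PR.range →L[ℂ] c.PR.range) (x : G.H2Data) :
    G.robinPerturbation v₀ c T x =
      -Pi.single v₀ ((T (c.robinL (G.dataValue v₀ x)) : c.PR.range) : EuclideanSpace ℂ _) := rfl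

theorem dataCond_update [Fintype V] (C : ∀ v, VertexCondition (G.Ends v)) (v₀ : V)
    (c : VertexCondition (G.Ends v₀)) (T : c.PR.range →L[ℂ] c.PR.range) (x : G.H2Data) :
    (G.dataCond (Function.update C v₀ c) + G.robinPerturbation v₀ c T) x =
      G.dataCond (Function.update C v₀ (c.withRobin (c.Λ + T))) x := by
  rw [add_apply, robinPerturbation_apply]
  funext v
  rw [Pi.add_apply, Pi.neg_apply, dataCond, dataCond, ContinuousLinearMap.pi_apply,
    ContinuousLinearMap.pi_apply]
  rcases eq_or_ne v v₀ with rfl | hv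
  · rw [Function.update_self, Function.update_self, Pi.single_eq_same,
      VertexCondition.condOp_withRobin, sub_eq_add_neg]
  · rw [Function.update_of_ne hv, Function.update_of_ne hv, Pi.single_eq_of_ne hv, neg_zero,
      add_zero]

/-- Green's formula for two functions whose vertex conditions differ by a change of the Robin
operator at one vertex. -/
theorem green_robinPerturbation [Fintype V] (q : G.Potential) {v₀ : V}
    {C : ∀ v, VertexCondition (G.Ends v)}
    (hC : ∀ v, v ≠ v₀ → LinearMap.IsSymmetric (𝕜 := ℂ) (E := (C v).PR.range) (C v).Λ)
    {c : VertexCondition (G.Ends v₀)}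
    (hc : LinearMap.IsSymmetric (𝕜 := ℂ) (E := c.PR.range) c.Λ)
    {T : c.PR.range →L[ℂ] c.PR.range} {x y : G.H2Data}
    (hx : G.dataCond (Function.update C v₀ c) x = 0)
    (hy : G.dataCond (Function.update C v₀ (c.withRobin (c.Λ + T))) y = 0) :
    inner ℂ (G.dataFun x) (G.dataHam q y) - inner ℂ (G.dataHam q x) (G.dataFun y) =
      inner ℂ (c.robinL (G.dataValue v₀ x)) (T (c.robinL (G.dataValue v₀ y))) := by
  rw [dataCond_eq_zero_iff] at hx hy
  rw [inner_dataFun_dataHam, Finset.sum_eq_single v₀]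
  · have h1 := hx v₀
    have h2 := hy v₀
    rw [Function.update_self] at h1 h2
    exact c.boundary_form hc h1 h2
  · intro v _ hv
    have h1 := hx v
    have h2 := hy v
    rw [Function.update_of_ne hv] at h1 h2
    have h3 : ((C v).withRobin ((C v).Λ + 0)).Holds (G.dataValue v y) (G.dataDeriv v y) := by
      rw [add_zero]
      exact h2
    rw [(C v).boundary_form (hC v hv) h1 h3]
    exact inner_zero_right (𝕜 := ℂ) (E := (C v).PR.range) _
  · exact fun h => absurd (Finset.mem_univ _) h

theorem mem_eigenspaceOf_iff (q : G.Potential) (C : ∀ v, VertexCondition (G.Ends v))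
    (ν : ℂ) (f : G.L2) : f ∈ eigenspaceOf (G.hamiltonian q C) ν ↔
      ∃ x, G.dataFun x = f ∧ G.dataHam q x = ν • G.dataFun x ∧ G.dataCond C x = 0 := by
  simp only [dataCond_eq_zero_iff, mem_eigenspaceOf_hamiltonian]

/-- Each edge carries two integration constants and has two ends, and each end contributes one
scalar vertex condition. The border adds one dimension to both sides. -/
theorem finrank_bdry [Fintype V] :
    Module.finrank ℂ (((E → ℂ) × (E → ℂ)) × ℂ) =
      Module.finrank ℂ ((∀ v, EuclideanSpace ℂ (G.Ends v)) × ℂ) := by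
  have h1 : ∑ v, Fintype.card (G.Ends v) = Fintype.card E * 2 := by
    rw [← Fintype.card_sigma, Fintype.card_congr (Equiv.sigmaFiberEquiv
      fun p : E × Bool => if p.2 then G.t p.1 else G.o p.1), Fintype.card_prod, Fintype.card_bool]
  rw [Module.finrank_prod, Module.finrank_prod, Module.finrank_prod,
    Module.finrank_pi_fintype ℂ (M := fun v => EuclideanSpace ℂ (G.Ends v))]
  simp only [finrank_euclideanSpace, h1, Module.finrank_fintype_fun_eq_card]
  ring

/-- At a simple eigenvalue the bordered operator is bijective. -/
theorem bijective_borderedOp [Fintype V] (q : G.Potential) {v₀ : V}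
    {C : ∀ v, VertexCondition (G.Ends v)}
    (hC : ∀ v, v ≠ v₀ → LinearMap.IsSymmetric (𝕜 := ℂ) (E := (C v).PR.range) (C v).Λ)
    {c : VertexCondition (G.Ends v₀)}
    (hc : LinearMap.IsSymmetric (𝕜 := ℂ) (E := c.PR.range) c.Λ) {l : ℝ}
    (hs : IsSimpleEigenvalue (G.hamiltonian q (Function.update C v₀ c)) l) {x₀ : G.H2Data}
    (hA : G.dataHam q x₀ = (l : ℂ) • G.dataFun x₀)
    (hB : G.dataCond (Function.update C v₀ c) x₀ = 0) (hn : ‖G.dataFun x₀‖ = 1) :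
    Function.Bijective (borderedOp G.dataFun (G.dataHam q) (G.dataCond (Function.update C v₀ c))
      (G.dataFun x₀) l) := by
  have hn' : inner ℂ (G.dataFun x₀) (G.dataFun x₀) = 1 := by
    rw [inner_self_eq_norm_sq_to_K, hn]; norm_num
  have hinj : Function.Injective (borderedOp G.dataFun (G.dataHam q)
      (G.dataCond (Function.update C v₀ c)) (G.dataFun x₀) l) := by
    refine (injective_iff_map_eq_zero _).2 ?_
    rintro ⟨x, t⟩ h
    rw [borderedOp_apply, Prod.mk_eq_zero, Prod.mk_eq_zero] at h
    obtain ⟨h1, h2, h3⟩ := h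
    simp only at h1 h2 h3
    -- For the unperturbed symmetric conditions this gives `⟨J x₀, A x⟩ = l ⟨J x₀, J x⟩ = 0`.
    -- Pairing the first equation with `J x₀` then leaves only `t`.
    have hg := G.green_robinPerturbation q hC hc (T := 0) hB (y := x)
      (by rw [add_zero]; exact h2)
    have h0 : inner ℂ (c.robinL (G.dataValue v₀ x₀))
        ((0 : c.PR.range →L[ℂ] c.PR.range) (c.robinL (G.dataValue v₀ x))) = 0 :=
      inner_zero_right (𝕜 := ℂ) (E := c.PR.range) _
    rw [h0, hA, inner_smul_left, h3, mul_zero, sub_zero] at hg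
    have ht : t = 0 := by
      have h4 := congrArg (inner ℂ (G.dataFun x₀)) h1
      rw [inner_sub_right, inner_sub_right, inner_smul_right, inner_smul_right, hg, h3, hn',
        inner_zero_right] at h4
      simpa using h4
    rw [ht, zero_smul, sub_zero, sub_eq_zero] at h1
    -- With `t = 0`, `x` gives an element of the one-dimensional eigenspace orthogonal to its
    -- generator, hence zero.
    have hx : G.dataFun x ∈ eigenspaceOf (G.hamiltonian q (Function.update C v₀ c)) l :=
      (G.mem_eigenspaceOf_iff q _ _ _).2 ⟨x, rfl, h1, h2⟩
    have hx₀ : G.dataFun x₀ ∈ eigenspaceOf (G.hamiltonian q (Function.update C v₀ c)) l :=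
      (G.mem_eigenspaceOf_iff q _ _ _).2 ⟨x₀, rfl, hA, hB⟩
    have hne : (⟨_, hx₀⟩ : eigenspaceOf (G.hamiltonian q (Function.update C v₀ c)) l) ≠ 0 := by
      intro h
      rw [Subtype.ext_iff] at h
      simp only [ZeroMemClass.coe_zero] at h
      rw [h, norm_zero] at hn
      exact zero_ne_one hn
    obtain ⟨a, ha⟩ := (finrank_eq_one_iff_of_nonzero' _ hne).1 hs ⟨_, hx⟩
    have ha' : a • G.dataFun x₀ = G.dataFun x := congrArg Subtype.val ha
    rw [← ha', inner_smul_right, hn', mul_one] at h3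
    rw [h3, zero_smul] at ha'
    have hx0 : x = 0 := G.dataFun_injective (by rw [← ha', map_zero])
    rw [hx0, ht]
    rfl
  refine ⟨hinj, ?_⟩
  -- Regrouping: the second derivative is the infinite-dimensional block, while integration
  -- constants and border variable form the finite-dimensional one.
  let a : (G.L2 × (((E → ℂ) × (E → ℂ)) × ℂ)) ≃ₗ[ℂ] (G.H2Data × ℂ) :=
    (LinearEquiv.prodAssoc ℂ G.L2 ((E → ℂ) × (E → ℂ)) ℂ).symm
  have := surjective_of_injective_of_block G.finrank_bdry
    ((borderedOp G.dataFun (G.dataHam q) (G.dataCond (Function.update C v₀ c))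
      (G.dataFun x₀) l).toLinearMap ∘ₗ a.toLinearMap) (by
        convert G.bijective_dataHam_sub q l using 2 with h
        change (borderedOp G.dataFun (G.dataHam q) (G.dataCond (Function.update C v₀ c))
          (G.dataFun x₀) l ((h, 0, 0), 0)).1 = _
        rw [borderedOp_apply]
        simp) (hinj.comp a.injective)
  exact Function.Surjective.of_comp this

end MetricGraph

/-! ### Reparametrization and normalization of eigenvalue branches -/

/-- The new eigenvalue function only has to agree on the new neighbourhood with the old one composed
with `γ`; this freedom allows a complex branch with real values to be replaced by the coercion of a
real function. -/
theorem IsEigenBranch.comp {V E : Type*} [Fintype E] {G : MetricGraph V E} {P P' : Type*}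
    [NormedAddCommGroup P] [NormedSpace ℝ P] [NormedAddCommGroup P'] [NormedSpace ℝ P']
    {A : P → (G.L2 →ₗ.[ℂ] G.L2)} {U : Set P} {x₀ : P} {μ₀ : ℂ} {f₀ : G.L2} {μ : P → ℂ}
    {f : P → G.L2} (h : IsEigenBranch A U x₀ μ₀ f₀ μ f) {γ : P' → P} {U' : Set P'} {y₀ : P'}
    (hU' : IsOpen U') (hy₀ : y₀ ∈ U') (hγ₀ : γ y₀ = x₀) (hm : MapsTo γ U' U)
    (hγ : DifferentiableOn ℝ γ U') {μ' : P' → ℂ} (hμ : ∀ y ∈ U', μ' y = μ (γ y)) :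
    IsEigenBranch (fun y => A (γ y)) U' y₀ μ₀ f₀ μ' (fun y => f (γ y)) where
  isOpen := hU'
  mem := hy₀
  value_base := by rw [hμ y₀ hy₀, hγ₀, h.value_base]
  function_base := by rw [hγ₀, h.function_base]
  simple y hy := by
    rw [hμ y hy]
    exact h.simple _ (hm hy)
  isolated := by
    obtain ⟨ε, hε, h'⟩ := h.isolated
    refine ⟨ε, hε, fun y hy ν h1 h2 => ?_⟩
    rw [hμ y hy]
    exact h' _ (hm hy) ν h1 h2
  eigen y hy := by
    rw [hμ y hy]
    exact h.eigen _ (hm hy)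
  normalized y hy := h.normalized _ (hm hy)
  differentiable := h.differentiable.comp hγ hm
  differentiable_grad := h.differentiable_grad.comp hγ hm

/-- A branch of real eigenvalues along a curve of multiples of a fixed parameter. -/
theorem IsEigenBranch.along_multiples {V E : Type*} [Fintype E] {G : MetricGraph V E} {P : Type*}
    [NormedAddCommGroup P] [NormedSpace ℂ P] [NormedSpace ℝ P] [IsScalarTower ℝ ℂ P]
    {A : P → (G.L2 →ₗ.[ℂ] G.L2)} {U : Set P} {x₀ : P} {μ₀ : ℂ} {f₀ : G.L2} {μ : P → ℂ}
    {f : P → G.L2} (h : IsEigenBranch A U x₀ μ₀ f₀ μ f) (hμ : DifferentiableOn ℂ μ U)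
    {D : P →L[ℂ] ℂ} (hD : HasFDerivAt μ D x₀) {w : P} {s : ℝ → ℝ} {s' t₀ : ℝ} {W : Set ℝ}
    (hW : IsOpen W) (ht₀ : t₀ ∈ W) (hs : DifferentiableOn ℝ s W) (hs' : HasDerivAt s s' t₀)
    (hst : (s t₀ : ℂ) • w = x₀)
    (him : ∀ t, (s t : ℂ) • w ∈ U → (μ ((s t : ℂ) • w)).im = 0) :
    ∃ (U' : Set ℝ) (lam : ℝ → ℝ) (g : ℝ → G.L2), U' ⊆ W ∧
      IsEigenBranch (fun t => A ((s t : ℂ) • w)) U' t₀ μ₀ f₀ (fun t => (lam t : ℂ)) g ∧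
      DifferentiableOn ℝ lam U' ∧ HasDerivAt lam (s' * (D w).re) t₀ := by
  have hsc : DifferentiableOn ℝ (fun t => (s t : ℂ)) W :=
    Complex.ofRealCLM.differentiable.comp_differentiableOn hs
  have hγ : DifferentiableOn ℝ (fun t => (s t : ℂ) • w) W := hsc.smul_const w
  have hm : MapsTo (fun t => (s t : ℂ) • w) (W ∩ (fun t => (s t : ℂ) • w) ⁻¹' U) U :=
    fun t ht => ht.2
  have hγ' := hγ.mono (inter_subset_left (t := (fun t => (s t : ℂ) • w) ⁻¹' U))
  refine ⟨_, fun t => (μ ((s t : ℂ) • w)).re, fun t => f ((s t : ℂ) • w), inter_subset_left,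
    h.comp (hγ.continuousOn.isOpen_inter_preimage hW h.isOpen) ⟨ht₀, ?_⟩ hst hm hγ' ?_, ?_, ?_⟩
  · rw [mem_preimage, hst]
    exact h.mem
  · intro t ht
    refine Complex.ext (Complex.ofReal_re _) ?_
    rw [Complex.ofReal_im, him _ ht.2]
  · exact Complex.reCLM.differentiable.comp_differentiableOn
      ((hμ.restrictScalars ℝ).comp hγ' hm)
  · rw [← hst] at hD
    have h1 : HasDerivAt (fun t => (s t : ℂ)) (s' : ℂ) t₀ := hs'.ofReal_comp
    have h2 : HasDerivAt (fun t => (s t : ℂ) • w) ((s' : ℂ) • w) t₀ := h1.smul_const w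
    have hD' : HasFDerivAt μ (D.restrictScalars ℝ) ((s t₀ : ℂ) • w) := hD.restrictScalars ℝ
    have h3 := hD'.comp_hasDerivAt t₀ h2
    have h4 : HasDerivAt (fun t => (μ ((s t : ℂ) • w)).re) (D ((s' : ℂ) • w)).re t₀ :=
      Complex.reCLM.hasFDerivAt.comp_hasDerivAt t₀ h3
    rwa [map_smul, smul_eq_mul, Complex.re_ofReal_mul] at h4

/-- Normalization of a differentiable family of vectors. -/
theorem differentiableOn_inv_norm_smul {P X H : Type*} [NormedAddCommGroup P] [NormedSpace ℝ P]
    [NormedAddCommGroup X] [NormedSpace ℂ X] [NormedSpace ℝ X] [IsScalarTower ℝ ℂ X]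
    [NormedAddCommGroup H] [InnerProductSpace ℂ H] [NormedSpace ℝ H] [IsScalarTower ℝ ℂ H]
    (J : X →L[ℂ] H) {ξ : P → X} {U : Set P}
    (hξ : DifferentiableOn ℝ ξ U) (h0 : ∀ p ∈ U, J (ξ p) ≠ 0) :
    DifferentiableOn ℝ (fun p => ((‖J (ξ p)‖⁻¹ : ℝ) : ℂ) • ξ p) U := by
  have h1 : DifferentiableOn ℝ (fun p => J (ξ p)) U :=
    (J.restrictScalars ℝ).differentiable.comp_differentiableOn hξ
  have h2 : DifferentiableOn ℝ (fun p => ‖J (ξ p)‖⁻¹) U :=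
    (h1.norm ℂ h0).inv fun p hp => norm_ne_zero_iff.2 (h0 p hp)
  have h3 : DifferentiableOn ℝ (fun p => ((‖J (ξ p)‖⁻¹ : ℝ) : ℂ)) U :=
    Complex.ofRealCLM.differentiable.comp_differentiableOn h2
  exact h3.smul hξ

/-! ### Continuation of simple eigenvalues of the Schrödinger operator -/

namespace MetricGraph

variable {V E : Type*} [Fintype E] (G : MetricGraph V E)

/-- A differentiable family of data spanning the eigenspaces gives a branch of normalized
eigenfunctions. -/
theorem isEigenBranch_of_span {P : Type*} [NormedAddCommGroup P] [NormedSpace ℂ P]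
    [NormedSpace ℝ P] [IsScalarTower ℝ ℂ P] {A : P → (G.L2 →ₗ.[ℂ] G.L2)} {U : Set P} {p₀ : P}
    {l₀ : ℂ} {x₀ : G.H2Data} {l : P → ℂ} {ξ : P → G.H2Data} (hU : IsOpen U) (hp₀ : p₀ ∈ U)
    (hl₀ : l p₀ = l₀) (hξ₀ : ξ p₀ = x₀) (hn : ‖G.dataFun x₀‖ = 1) (hξ : DifferentiableOn ℂ ξ U)
    (hne : ∀ p ∈ U, G.dataFun (ξ p) ≠ 0)
    (hspan : ∀ p ∈ U, eigenspaceOf (A p) (l p) = Submodule.span ℂ {G.dataFun (ξ p)})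
    (hiso : ∃ ε > 0, ∀ p ∈ U, ∀ ν : ℂ, ‖ν - l₀‖ < ε → eigenspaceOf (A p) ν ≠ ⊥ → ν = l p) :
    ∃ f : P → G.L2, IsEigenBranch A U p₀ l₀ (G.dataFun x₀) l f := by
  -- The norm is only real-differentiable, so the normalized eigenfunction is treated over `ℝ`
  -- although `ξ` is complex differentiable.
  have hη : DifferentiableOn ℝ (fun p => ((‖G.dataFun (ξ p)‖⁻¹ : ℝ) : ℂ) • ξ p) U :=
    differentiableOn_inv_norm_smul G.dataFun (hξ.restrictScalars ℝ) hne
  refine ⟨fun p => G.dataFun (((‖G.dataFun (ξ p)‖⁻¹ : ℝ) : ℂ) • ξ p), hU, hp₀, hl₀, ?_, ?_, hiso,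
    ?_, ?_, ?_, ?_⟩
  · rw [hξ₀, hn]
    simp
  · intro p hp
    rw [IsSimpleEigenvalue, hspan p hp]
    exact finrank_span_singleton (hne _ hp)
  · intro p hp
    rw [hspan p hp, map_smul]
    exact Submodule.smul_mem _ _ (Submodule.mem_span_singleton_self _)
  · intro p hp
    rw [map_smul, norm_smul, Complex.norm_real, norm_inv, norm_norm,
      inv_mul_cancel₀ (norm_ne_zero_iff.2 (hne _ hp))]
  · exact (G.dataFun.restrictScalars ℝ).differentiable.comp_differentiableOn hη
  -- The gradient is a bounded linear image of the data, so differentiability into `H¹` is inherited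
  -- from the data.
  · simp only [grad_dataFun]
    exact (G.dataGrad.restrictScalars ℝ).differentiable.comp_differentiableOn hη

variable [Fintype V] [DecidableEq V]

/-- Eigenvalues are real if all Robin operators are self-adjoint. -/
theorem im_eq_zero_of_isSymmetric (q : G.Potential) {v₀ : V}
    {C : ∀ v, VertexCondition (G.Ends v)}
    (hC : ∀ v, v ≠ v₀ → LinearMap.IsSymmetric (𝕜 := ℂ) (E := (C v).PR.range) (C v).Λ)
    {c : VertexCondition (G.Ends v₀)}
    (hc : LinearMap.IsSymmetric (𝕜 := ℂ) (E := c.PR.range) c.Λ) {l : ℂ} {x : G.H2Data}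
    (hA : G.dataHam q x = l • G.dataFun x) (hB : G.dataCond (Function.update C v₀ c) x = 0)
    (hx : G.dataFun x ≠ 0) : l.im = 0 := by
  have hg := G.green_robinPerturbation q hC hc (T := 0) hB (y := x)
    (by rw [add_zero]; exact hB)
  have h3 : inner ℂ (c.robinL (G.dataValue v₀ x))
      ((0 : c.PR.range →L[ℂ] c.PR.range) (c.robinL (G.dataValue v₀ x))) = 0 :=
    inner_zero_right (𝕜 := ℂ) (E := c.PR.range) _
  rw [h3, hA, inner_smul_right, inner_smul_left, ← sub_mul] at hg
  have h4 := (mul_eq_zero.1 hg).resolve_right (inner_self_ne_zero.2 hx)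
  exact Complex.conj_eq_iff_im.1 (sub_eq_zero.1 h4).symm

/-- Continuation of a simple eigenvalue along changes of the Robin operator at one vertex. -/
theorem exists_isEigenBranch_robin (q : G.Potential) {v₀ : V}
    {C : ∀ v, VertexCondition (G.Ends v)}
    (hC : ∀ v, v ≠ v₀ → LinearMap.IsSymmetric (𝕜 := ℂ) (E := (C v).PR.range) (C v).Λ)
    {c : VertexCondition (G.Ends v₀)}
    (hc : LinearMap.IsSymmetric (𝕜 := ℂ) (E := c.PR.range) c.Λ) {l₀ : ℝ} {f₀ : G.L2}
    (hs : IsSimpleEigenvalue (G.hamiltonian q (Function.update C v₀ c)) l₀)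
    (hf : f₀ ∈ eigenspaceOf (G.hamiltonian q (Function.update C v₀ c)) l₀) (hn : ‖f₀‖ = 1) :
    ∃ (U : Set (c.PR.range →L[ℂ] c.PR.range)) (lam : (c.PR.range →L[ℂ] c.PR.range) → ℂ)
      (f : (c.PR.range →L[ℂ] c.PR.range) → G.L2),
      IsEigenBranch (fun Λ => G.hamiltonian q (Function.update C v₀ (c.withRobin Λ)))
        U c.Λ l₀ f₀ lam f ∧
      DifferentiableOn ℂ lam U ∧
      (∀ Λ ∈ U, LinearMap.IsSymmetric (𝕜 := ℂ) (E := c.PR.range) Λ → (lam Λ).im = 0) ∧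
      ∃ D : (c.PR.range →L[ℂ] c.PR.range) →L[ℂ] ℂ,
        HasFDerivAt lam D c.Λ ∧
        ∀ T : c.PR.range →L[ℂ] c.PR.range,
          D T = inner ℂ (c.robinPart (G.bdryValue f₀ v₀))
            (T (c.robinPart (G.bdryValue f₀ v₀))) := by
  obtain ⟨x₀, rfl, hA, hB⟩ := (G.mem_eigenspaceOf_iff q _ _ _).1 hf
  let κ : (c.PR.range →L[ℂ] c.PR.range) →L[ℂ] G.H2Data →L[ℂ] ℂ :=
    sandwichL (innerSL ℂ (c.robinL (G.dataValue v₀ x₀))) (c.robinL ∘L G.dataValue v₀)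
  have hκ : ∀ T x, κ T x =
      inner ℂ (c.robinL (G.dataValue v₀ x₀)) (T (c.robinL (G.dataValue v₀ x))) := fun _ _ => rfl
  have hgreen : ∀ (T : c.PR.range →L[ℂ] c.PR.range) x,
      (G.dataCond (Function.update C v₀ c) + G.robinPerturbation v₀ c T) x = 0 →
        inner ℂ (G.dataFun x₀) (G.dataHam q x - (l₀ : ℂ) • G.dataFun x) = κ T x := by
    intro T x hx
    rw [dataCond_update] at hx
    rw [hκ, ← G.green_robinPerturbation q hC hc hB hx, hA, inner_sub_right, inner_smul_right,
      inner_smul_left, Complex.conj_ofReal]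
  have key := exists_eigenpair_continuation_at (P := c.PR.range →L[ℂ] c.PR.range) G.dataFun
    (G.dataHam q) (G.dataCond (Function.update C v₀ c)) (G.robinPerturbation v₀ c) κ l₀ x₀ c.Λ
  have key := key hA hB hn
  have key := key (by
    intro T x hx
    exact hgreen T x hx)
  have key := key (G.bijective_borderedOp q hC hc hs hA hB hn)
  obtain ⟨U, l, ξ, hU, h0U, hl0, hξ0, hl, hξ, heig, ⟨ε, hε, hlε, huniq⟩, D, hD, hDT⟩ :=
    key
  have hcond : ∀ (Λ : c.PR.range →L[ℂ] c.PR.range) x,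
      (G.dataCond (Function.update C v₀ c) + G.robinPerturbation v₀ c (Λ - c.Λ)) x =
        G.dataCond (Function.update C v₀ (c.withRobin Λ)) x := by
    intro Λ x
    rw [dataCond_update, add_sub_cancel]
  simp only [hcond] at heig huniq
  obtain ⟨f, hb⟩ := G.isEigenBranch_of_span
    (A := fun Λ => G.hamiltonian q (Function.update C v₀ (c.withRobin Λ))) hU h0U hl0 hξ0 hn hξ
    (fun Λ hΛ => (heig Λ hΛ).2.2)
    (by
      intro Λ hΛ
      ext g
      rw [mem_eigenspaceOf_iff, Submodule.mem_span_singleton]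
      constructor
      · rintro ⟨x, rfl, h1, h2⟩
        rcases eq_or_ne x 0 with rfl | hx
        · exact ⟨0, by rw [zero_smul, map_zero]⟩
        -- Uniqueness is used at the spectral value `l Λ` itself, which `hlε` places within `ε` of
        -- `l₀`.
        · obtain ⟨-, a, rfl⟩ := huniq Λ hΛ _ (hlε _ hΛ) x hx h1 h2
          exact ⟨a, (map_smul _ _ _).symm⟩
      · rintro ⟨a, rfl⟩
        obtain ⟨h1, h2, -⟩ := heig _ hΛ
        refine ⟨a • ξ Λ, map_smul _ _ _, ?_, ?_⟩
        · rw [map_smul, map_smul, h1, smul_comm]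
        · rw [map_smul, h2, smul_zero])
    (by
      refine ⟨ε, hε, fun Λ hΛ ν hν hbot => ?_⟩
      obtain ⟨g, hg, hg0⟩ := (Submodule.ne_bot_iff _).1 hbot
      obtain ⟨x, rfl, h1, h2⟩ := (G.mem_eigenspaceOf_iff q _ _ _).1 hg
      have hx : x ≠ 0 := by
        rintro rfl
        exact hg0 (map_zero _)
      exact (huniq Λ hΛ ν hν x hx h1 h2).1)
  refine ⟨U, l, f, hb, hl, fun Λ hΛ hΛs => ?_, ?_⟩
  · obtain ⟨h1, h2, h3⟩ := heig Λ hΛ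
    exact G.im_eq_zero_of_isSymmetric q hC (c := c.withRobin Λ) hΛs h1 h2 h3
  · refine ⟨D, hD, fun T => ?_⟩
    rw [hDT, bdryValue_dataFun]
    rfl

end MetricGraph

/-! ### Curves of scalar Robin operators -/

namespace MetricGraph

variable {V E : Type*} [Fintype V] [DecidableEq V] [Fintype E] (G : MetricGraph V E)

theorem _root_.VertexCondition.isSymmetric_real_smul_one {ι : Type*} [Fintype ι]
    (c : VertexCondition ι) (r : ℝ) : LinearMap.IsSymmetric (𝕜 := ℂ) (E := c.PR.range)
      (((r : ℂ) • (1 : c.PR.range →L[ℂ] c.PR.range) : c.PR.range →L[ℂ] c.PR.range) :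
        c.PR.range →ₗ[ℂ] c.PR.range) := by
  intro x y
  change inner ℂ ((r : ℂ) • (x : EuclideanSpace ℂ ι)) (y : EuclideanSpace ℂ ι) =
    inner ℂ (x : EuclideanSpace ℂ ι) ((r : ℂ) • (y : EuclideanSpace ℂ ι))
  rw [inner_smul_left, inner_smul_right, Complex.conj_ofReal]

/-- Continuation of a simple eigenvalue along a curve of real multiples of the identity as Robin
operators. -/
theorem exists_isEigenBranch_curve (q : G.Potential) {v₀ : V}
    {C : ∀ v, VertexCondition (G.Ends v)}
    (hC : ∀ v, v ≠ v₀ → LinearMap.IsSymmetric (𝕜 := ℂ) (E := (C v).PR.range) (C v).Λ)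
    {c : VertexCondition (G.Ends v₀)} {l₀ : ℝ} {f₀ : G.L2}
    (hs : IsSimpleEigenvalue (G.hamiltonian q (Function.update C v₀ c)) l₀)
    (hf : f₀ ∈ eigenspaceOf (G.hamiltonian q (Function.update C v₀ c)) l₀) (hn : ‖f₀‖ = 1)
    {s : ℝ → ℝ} {s' t₀ : ℝ} {W : Set ℝ} (hW : IsOpen W) (ht₀ : t₀ ∈ W)
    (hsd : DifferentiableOn ℝ s W) (hs' : HasDerivAt s s' t₀) (hst : (s t₀ : ℂ) • 1 = c.Λ) :
    ∃ (U : Set ℝ) (lam : ℝ → ℝ) (f : ℝ → G.L2), U ⊆ W ∧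
      IsEigenBranch (fun t => G.hamiltonian q
        (Function.update C v₀ (c.withRobin ((s t : ℂ) • 1))))
        U t₀ l₀ f₀ (fun t => (lam t : ℂ)) f ∧
      DifferentiableOn ℝ lam U ∧
      HasDerivAt lam (s' * ‖c.PR (G.bdryValue f₀ v₀)‖ ^ 2) t₀ := by
  have hc : LinearMap.IsSymmetric (𝕜 := ℂ) (E := c.PR.range) c.Λ :=
    hst ▸ c.isSymmetric_real_smul_one (s t₀)
  obtain ⟨U, lam, f, hb, hl, him, D, hD, hDT⟩ := G.exists_isEigenBranch_robin q hC hc hs hf hn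
  have key := hb.along_multiples hl hD hW ht₀ hsd hs' hst
    fun t ht => him _ ht (c.isSymmetric_real_smul_one (s t))
  -- The curve runs along multiples of the identity, and in that direction the derivative form is
  -- the squared norm of the Robin part.
  have e : (D 1).re = ‖c.PR (G.bdryValue f₀ v₀)‖ ^ 2 := by
    rw [hDT]
    change (inner ℂ (c.PR (G.bdryValue f₀ v₀)) (c.PR (G.bdryValue f₀ v₀))).re = _
    rw [inner_self_eq_norm_sq_to_K]
    norm_cast
  rw [e] at key
  exact key

end MetricGraph

/-! ### The `δ` and `δ'` coupling conditions -/

namespace VertexCondition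

variable {ι : Type*} [Fintype ι]

theorem starProjection_onesLine [Nonempty ι] (F : EuclideanSpace ℂ ι) :
    (onesLine ι).starProjection F =
      ((∑ i, F i) / Fintype.card ι) • WithLp.toLp 2 fun _ => (1 : ℂ) := by
  rw [onesLine, Submodule.starProjection_singleton]
  congr 1
  · simp [PiLp.inner_apply, EuclideanSpace.norm_sq_eq]

/-- The projection is the mean of the entries times the vector of ones, whose squared norm is the
number of entries. -/
theorem norm_sq_starProjection_onesLine [Nonempty ι] (F : EuclideanSpace ℂ ι) :
    ‖(onesLine ι).starProjection F‖ ^ 2 = ‖∑ i, F i‖ ^ 2 / Fintype.card ι := by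
  have hd : (Fintype.card ι : ℝ) ≠ 0 := by exact_mod_cast Fintype.card_ne_zero
  rw [starProjection_onesLine, norm_smul, mul_pow, EuclideanSpace.norm_sq_eq]
  simp
  field_simp

end VertexCondition

end

/-- `inner` is conjugate-linear in its first argument, so the derivative at `T` is the form `⟨T F,
F⟩` in the convention linear in the first argument. In the `δ'` case a single branch serves both
parameters, related by inversion. -/
theorem mainTheorem3 {V E : Type*} [Fintype V] [DecidableEq V] [Fintype E] (G : MetricGraph V E)
    (q : G.Potential) (v₀ : V) (C : ∀ v, VertexCondition (G.Ends v))
    (hC : ∀ v, v ≠ v₀ → (C v).IsSelfAdjointCondition) :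
    -- general Robin part at `v₀`: Fréchet derivative with respect to `Λ`
    ((C v₀).IsSelfAdjointCondition → (C v₀).PR ≠ 0 → ∀ (lam₀ : ℝ) (f₀ : G.L2),
      IsSimpleEigenvalue (G.hamiltonian q C) lam₀ →
      f₀ ∈ eigenspaceOf (G.hamiltonian q C) lam₀ → ‖f₀‖ = 1 →
      ∃ (U : Set ((C v₀).PR.range →L[ℂ] (C v₀).PR.range))
        (lam : ((C v₀).PR.range →L[ℂ] (C v₀).PR.range) → ℂ)
        (f : ((C v₀).PR.range →L[ℂ] (C v₀).PR.range) → G.L2),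
        IsEigenBranch
          (fun Λ => G.hamiltonian q (Function.update C v₀ ((C v₀).withRobin Λ)))
          U (C v₀).Λ lam₀ f₀ lam f ∧
        DifferentiableOn ℂ lam U ∧
        (∀ Λ ∈ U, LinearMap.IsSymmetric (𝕜 := ℂ) (E := (C v₀).PR.range) Λ → (lam Λ).im = 0) ∧
        ∃ D : ((C v₀).PR.range →L[ℂ] (C v₀).PR.range) →L[ℂ] ℂ,
          HasFDerivAt lam D (C v₀).Λ ∧
          ∀ T : (C v₀).PR.range →L[ℂ] (C v₀).PR.range,
            D T = inner ℂ ((C v₀).robinPart (G.bdryValue f₀ v₀))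
              (T ((C v₀).robinPart (G.bdryValue f₀ v₀)))) ∧
    -- `δ` coupling condition of strength `α` at `v₀`
    (0 < G.deg v₀ → ∀ (α₀ lam₀ : ℝ) (f₀ : G.L2),
      IsSimpleEigenvalue
        (G.hamiltonian q (Function.update C v₀ (VertexCondition.delta (G.Ends v₀) α₀))) lam₀ →
      f₀ ∈ eigenspaceOf
        (G.hamiltonian q (Function.update C v₀ (VertexCondition.delta (G.Ends v₀) α₀))) lam₀ →
      ‖f₀‖ = 1 →
      ∃ (U : Set ℝ) (lam : ℝ → ℝ) (f : ℝ → G.L2),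
        IsEigenBranch
          (fun α => G.hamiltonian q (Function.update C v₀ (VertexCondition.delta (G.Ends v₀) α)))
          U α₀ lam₀ f₀ (fun α => (lam α : ℂ)) f ∧
        DifferentiableOn ℝ lam U ∧
        ∃ c : ℂ, (∀ i, G.bdryValue f₀ v₀ i = c) ∧ HasDerivAt lam (‖c‖ ^ 2) α₀) ∧
    -- `δ'` coupling condition of strength `β ≠ 0` at `v₀`
    (0 < G.deg v₀ → ∀ (β₀ lam₀ : ℝ) (f₀ : G.L2), β₀ ≠ 0 →
      IsSimpleEigenvalue
        (G.hamiltonian q (Function.update C v₀ (VertexCondition.deltaPrime (G.Ends v₀) β₀))) lam₀ →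
      f₀ ∈ eigenspaceOf
        (G.hamiltonian q (Function.update C v₀ (VertexCondition.deltaPrime (G.Ends v₀) β₀))) lam₀ →
      ‖f₀‖ = 1 →
      ∃ (U : Set ℝ) (lam : ℝ → ℝ) (f : ℝ → G.L2), (0 : ℝ) ∉ U ∧
        IsEigenBranch
          (fun β => G.hamiltonian q
            (Function.update C v₀ (VertexCondition.deltaPrime (G.Ends v₀) β)))
          U β₀ lam₀ f₀ (fun β => (lam β : ℂ)) f ∧
        IsEigenBranch
          (fun s => G.hamiltonian q
            (Function.update C v₀ (VertexCondition.deltaPrime (G.Ends v₀) s⁻¹)))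
          {s | s⁻¹ ∈ U} β₀⁻¹ lam₀ f₀ (fun s => (lam s⁻¹ : ℂ)) (fun s => f s⁻¹) ∧
        DifferentiableOn ℝ lam U ∧
        DifferentiableOn ℝ (fun s => lam s⁻¹) {s | s⁻¹ ∈ U} ∧
        HasDerivAt (fun s => lam s⁻¹) (‖∑ i, G.bdryValue f₀ v₀ i‖ ^ 2) β₀⁻¹ ∧
        HasDerivAt lam (-(1 / β₀ ^ 2) * ‖∑ i, G.bdryValue f₀ v₀ i‖ ^ 2) β₀) := by
  have hC' : ∀ v, v ≠ v₀ → LinearMap.IsSymmetric (𝕜 := ℂ) (E := (C v).PR.range) (C v).Λ :=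
    fun v hv => (hC v hv).1
  refine ⟨?_, ?_, ?_⟩
  · intro h0 _ lam₀ f₀ hs hf hn
    have hu : C = Function.update C v₀ (C v₀) := (Function.update_eq_self v₀ C).symm
    refine G.exists_isEigenBranch_robin q hC' h0.1 ?_ ?_ hn
    · rwa [← hu]
    · rwa [← hu]
  · intro hd α₀ lam₀ f₀ hs hf hn
    have : Nonempty (G.Ends v₀) := Fintype.card_pos_iff.1 hd
    have hd' : (Fintype.card (G.Ends v₀) : ℝ) ≠ 0 := by exact_mod_cast Fintype.card_ne_zero
    -- The projections of the `δ` condition do not depend on its strength, so replacing the Robin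
    -- operator by `α / d` gives the condition of strength `α` by definition.
    obtain ⟨U, lam, f, -, h1, h2, h3⟩ := G.exists_isEigenBranch_curve q hC'
      (s := fun α => α / Fintype.card (G.Ends v₀)) hs hf hn isOpen_univ (mem_univ α₀)
      (differentiable_id.div_const _).differentiableOn
      ((hasDerivAt_id α₀).div_const _) rfl
    obtain ⟨x, rfl, -, hx⟩ := (G.mem_eigenspaceOf_hamiltonian q _ _ _).1 hf
    have hx0 := hx v₀
    rw [Function.update_self] at hx0
    have hD : (VertexCondition.onesLine (G.Ends v₀))ᗮ.starProjection
      (G.bdryValue (G.dataFun x) v₀) = 0 := by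
      rw [G.bdryValue_dataFun]
      exact hx0.1
    -- The Dirichlet part says that the boundary vector lies in the double orthogonal complement of
    -- the line of ones, hence in that line; its coefficient is the common value.
    rw [Submodule.starProjection_apply_eq_zero_iff, Submodule.orthogonal_orthogonal,
      VertexCondition.onesLine, Submodule.mem_span_singleton] at hD
    obtain ⟨c, hc⟩ := hD
    have hci : ∀ i, G.bdryValue (G.dataFun x) v₀ i = c := fun i => by rw [← hc]; simp
    refine ⟨U, lam, f, h1, h2, c, hci, ?_⟩
    have e : ‖(VertexCondition.delta (G.Ends v₀) α₀).PR (G.bdryValue (G.dataFun x) v₀)‖ ^ 2 =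
        Fintype.card (G.Ends v₀) * ‖c‖ ^ 2 := by
      refine (VertexCondition.norm_sq_starProjection_onesLine _).trans ?_
      simp only [hci, Finset.sum_const, Finset.card_univ, nsmul_eq_mul, norm_mul,
        Complex.norm_natCast]
      field_simp
    rw [e] at h3
    convert h3 using 1
    field_simp
  · intro hd β₀ lam₀ f₀ hβ hs hf hn
    have : Nonempty (G.Ends v₀) := Fintype.card_pos_iff.1 hd
    have hd' : (Fintype.card (G.Ends v₀) : ℝ) ≠ 0 := by exact_mod_cast Fintype.card_ne_zero
    obtain ⟨U, lam, f, hUW, h1, h2, h3⟩ := G.exists_isEigenBranch_curve q hC'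
      (s := fun β => Fintype.card (G.Ends v₀) / β) hs hf hn isOpen_compl_singleton
      (mem_compl_singleton_iff.2 hβ)
      (fun β (hb : β ≠ 0) => ((hasDerivAt_const β (Fintype.card (G.Ends v₀) : ℝ)).div
        (hasDerivAt_id β) hb).differentiableAt.differentiableWithinAt)
      ((hasDerivAt_const β₀ (Fintype.card (G.Ends v₀) : ℝ)).div (hasDerivAt_id β₀) hβ) rfl
    have h0U : (0 : ℝ) ∉ U := fun h => hUW h rfl
    have e : ‖(VertexCondition.deltaPrime (G.Ends v₀) β₀).PR (G.bdryValue f₀ v₀)‖ ^ 2 =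
        ‖∑ i, G.bdryValue f₀ v₀ i‖ ^ 2 / Fintype.card (G.Ends v₀) :=
      VertexCondition.norm_sq_starProjection_onesLine _
    have h4 : HasDerivAt lam (-(1 / β₀ ^ 2) * ‖∑ i, G.bdryValue f₀ v₀ i‖ ^ 2) β₀ := by
      rw [e] at h3
      convert h3 using 1
      simp
      field_simp
    -- By convention `0⁻¹ = 0`, so `0 ∉ U` also excludes `s = 0`; inversion is therefore smooth on
    -- the whole set.
    have hne : ∀ s ∈ {s : ℝ | s⁻¹ ∈ U}, s ≠ 0 := by
      rintro s hs rfl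
      exact h0U (by simpa using hs)
    have hinv : DifferentiableOn ℝ (fun s : ℝ => s⁻¹) {s | s⁻¹ ∈ U} :=
      fun s hs => (differentiableAt_inv (hne s hs)).differentiableWithinAt
    have ho : IsOpen {s : ℝ | s⁻¹ ∈ U} := by
      have : {s : ℝ | s⁻¹ ∈ U} = {0}ᶜ ∩ (fun s : ℝ => s⁻¹) ⁻¹' U := by
        ext s
        exact ⟨fun h => ⟨hne s h, h⟩, fun h => h.2⟩
      rw [this]
      exact continuousOn_inv₀.isOpen_inter_preimage isOpen_compl_singleton h1.isOpen
    have hm : MapsTo (fun s : ℝ => s⁻¹) {s | s⁻¹ ∈ U} U := fun s hs => hs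
    refine ⟨U, lam, f, h0U, h1, ?_, h2, h2.comp hinv hm, ?_, h4⟩
    · exact h1.comp ho (by simpa using h1.mem) (inv_inv β₀) hm hinv fun s _ => rfl
    -- Chain rule for `β = s⁻¹`: at `s = β₀⁻¹` the inner derivative is `-β₀ ^ 2`, which cancels the
    -- factor `-1 / β₀ ^ 2`.
    · have h5 := hasDerivAt_inv (inv_ne_zero hβ)
      have h6 : HasDerivAt lam (-(1 / β₀ ^ 2) * ‖∑ i, G.bdryValue f₀ v₀ i‖ ^ 2) (β₀⁻¹)⁻¹ := by
        rwa [inv_inv]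
      have h7 : HasDerivAt (fun s => lam s⁻¹) (-(1 / β₀ ^ 2) *
          ‖∑ i, G.bdryValue f₀ v₀ i‖ ^ 2 * -((β₀⁻¹ ^ 2)⁻¹)) β₀⁻¹ := h6.comp β₀⁻¹ h5
      have e7 : -(1 / β₀ ^ 2) * ‖∑ i, G.bdryValue f₀ v₀ i‖ ^ 2 * -((β₀⁻¹ ^ 2)⁻¹) =
          ‖∑ i, G.bdryValue f₀ v₀ i‖ ^ 2 := by
        field_simp
      rwa [e7] at h7
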